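/- Let $m\ge 1$ and let $h_1,\dots,h_m:\mathbb{R}\to\mathbb{R}$ be integrable even functions, with Fourier transforms $\widehat h_i(t)=\int_{\mathbb R}e^{i\lambda t}h_i(\lambda)\,d\lambda$. For $T>0$ let $W_T(h_i)$ be the truncated Toeplitz operator on $L^2[0,T]$, $[W_T(h_i)u](t)=\int_0^T\widehat h_i(t-s)u(s)\,ds$, and put $$\Delta_W(T)=\Big|\frac1T\operatorname{tr}\big[W_T(h_1)W_T(h_2)\cdots W_T(h_m)\big]-(2\pi)^{m-1}\int_{\mathbb R}h_1(\lambda)\cdots h_m(\lambda)\,d\lambda\Big| .$$ Let $$\varphi(\mathbf u)=\int_{\mathbb R}h_1(\lambda)h_2(\lambda-u_1)\cdots h_m(\lambda-u_{m-1})\,d\lambda,\qquad \mathbf u=(u_1,\dots,u_{m-1})\in\mathbb R^{m-1},\qquad |\mathbf u|=|u_1|+\cdots+|u_{m-1}|$$ (since the $h_i$ are integrable, this is defined for almost every $\mathbf u$). For $1\le p\le\infty$ and $0<\gamma\le1$ let $\mathrm{Lip}(\mathbb R;p,\gamma)$ be the set of $\psi\in L^p(\mathbb R)$ with $\sup_{0<h\le\delta}\|\psi(\cdot+h)-\psi\|_p=O(\delta^\gamma)$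 as $\delta\to0$, and let $\mathcal F_1(\mathbb R)$ be the set of $f\in L^1(\mathbb R)$ with $\int_{\mathbb R}|t||\widehat f(t)|\,dt<\infty$. For every $T>0$ the operator $W_T(h_1)\cdots W_T(h_m)$ is of trace class, and the following assertions hold. (B1) If $h_i\in\mathcal F_1(\mathbb R)$ for $i=1,\dots,m$, then $h_1\cdots h_m$ is integrable and $\Delta_W(T)=O(T^{-1})$ as $T\to\infty$. (B2) Let $h_1\cdots h_m$ be integrable (so that $\varphi(\mathbf 0)$ is defined), let $\varphi\in L^\infty(\mathbb R^{m-1})$, and suppose that for some constants $C>0$ and $\gamma\in(0,1]$ we have $|\varphi(\mathbf u)-\varphi(\mathbf 0)|\le C|\mathbf u|^\gamma$ for almost every $\mathbf u\in\mathbb R^{m-1}$. Then for every $\varepsilon>0$, $\Delta_W(T)=O(T^{-\gamma+\varepsilon})$ as $T\to\infty$. (B3) Let $\gamma\in(0,1]$ and $h_i\in\mathrm{Lip}(\mathbb R;p_i,\gamma)$, $1\le p_i\le\infty$, $i=1,\dots,m$, with $1/p_1+\cdots+1/p_m\le1$. Then $h_1\cdots h_m$ is integrable and, for every $\varepsilon>0$,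 $\Delta_W(T)=O(T^{-\gamma+\varepsilon})$ as $T\to\infty$. (B4) Suppose that each $h_i$ is differentiable on $\mathbb R\setminus\{0\}$ and that there are constants $C_i>0$, $\sigma_i>0$, $\delta_i>1$, $i=1,\dots,m$, with $\sigma:=\sum_{i=1}^m\sigma_i<1$, such that $$|h_i(\lambda)|\le C_i|\lambda|^{-\sigma_i},\quad |h_i'(\lambda)|\le C_i|\lambda|^{-\sigma_i-1}\qquad(0<|\lambda|\le1),$$ $$|h_i(\lambda)|\le C_i|\lambda|^{-\delta_i},\quad |h_i'(\lambda)|\le C_i|\lambda|^{-\delta_i-1}\qquad(|\lambda|>1).$$ Then $h_1\cdots h_m$ is integrable and, for every $\varepsilon>0$, $\Delta_W(T)=O(T^{-\gamma+\varepsilon})$ as $T\to\infty$, with $\gamma=\frac1m(1-\sigma)$. -/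

import Mathlib

open MeasureTheory Filter Topology Asymptotics
open scoped ENNReal NNReal

noncomputable section

namespace ToeplitzTrace

/-! ### Trace class operators and their trace -/

section TraceClass

variable {H : Type*} [NormedAddCommGroup H] [InnerProductSpace ℂ H]

/-- A bounded operator `A` on a complex Hilbert space is of trace class (nuclear) if
`∑ |⟪f k, A (e k)⟫| < ∞` for all orthonormal sequences `e` and `f`. -/
def IsTraceClass (A : H →L[ℂ] H) : Prop :=
  ∀ e f : ℕ → H, Orthonormal ℂ e → Orthonormal ℂ f →
    Summable fun k => ‖inner ℂ (f k) (A (e k))‖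

variable [CompleteSpace H]

variable (H) in
/-- The index set of a fixed orthonormal basis of `H`. -/
def onbIndex : Set H := (exists_hilbertBasis ℂ H).choose

variable (H) in
/-- A fixed orthonormal basis of `H`. -/
def onb : HilbertBasis (onbIndex H) ℂ H := (exists_hilbertBasis ℂ H).choose_spec.choose

/-- The trace `∑ ⟪e i, A (e i)⟫`, `e` an orthonormal basis. For operators of trace class the
series converges absolutely and its sum does not depend on the basis. -/
def opTrace (A : H →L[ℂ] H) : ℂ :=
  ∑' i : onbIndex H, inner ℂ (onb H i) (A (onb H i))

end TraceClass

/-! ### Truncated Toeplitz operators -/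

/-- The Fourier transform `ĥ(t) = ∫ e^{iλt} h(λ) dλ`. -/
def hat (h : ℝ → ℝ) (t : ℝ) : ℂ :=
  ∫ l : ℝ, Complex.exp (Complex.I * l * t) * (h l : ℂ)

lemma norm_kernel (h : ℝ → ℝ) (t l : ℝ) :
    ‖Complex.exp (Complex.I * l * t) * (h l : ℂ)‖ = ‖h l‖ := by
  have : Complex.I * l * t = ((l * t : ℝ) : ℂ) * Complex.I := by push_cast; ring
  rw [norm_mul, this, Complex.norm_exp_ofReal_mul_I, one_mul, Complex.norm_real]

lemma norm_hat_le (h : ℝ → ℝ) (t : ℝ) : ‖hat h t‖ ≤ ∫ l, ‖h l‖ := by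
  refine (norm_integral_le_integral_norm _).trans (le_of_eq ?_)
  simp only [norm_kernel]

lemma continuous_hat (h : ℝ → ℝ) : Continuous (hat h) := by
  by_cases hh : Integrable h
  · refine continuous_of_dominated (bound := fun l => ‖h l‖) (fun t => ?_) (fun t => ?_)
      hh.norm ?_
    · exact (Continuous.aestronglyMeasurable (by fun_prop)).mul
        (Complex.continuous_ofReal.comp_aestronglyMeasurable hh.1)
    · exact ae_of_all _ fun l => (norm_kernel h t l).le
    · exact ae_of_all _ fun l => by fun_prop
  · have : hat h = fun _ => 0 := by
      funext t
      refine integral_undef fun hi => hh ?_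
      have hi2 : Integrable fun l : ℝ => Complex.exp (-(Complex.I * l * t)) *
          (Complex.exp (Complex.I * l * t) * (h l : ℂ)) := by
        refine hi.norm.mono'
          ((Continuous.aestronglyMeasurable (by fun_prop)).mul hi.1) (ae_of_all _ fun l => ?_)
        have : -(Complex.I * l * t) = ((-(l * t) : ℝ) : ℂ) * Complex.I := by push_cast; ring
        rw [norm_mul, this, Complex.norm_exp_ofReal_mul_I, one_mul]
      have hi3 : Integrable fun l : ℝ => (h l : ℂ) := by
        refine hi2.congr (ae_of_all _ fun l => ?_)
        simp only
        rw [← mul_assoc, ← Complex.exp_add, neg_add_cancel, Complex.exp_zero, one_mul]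
      exact hi3.re
    rw [this]
    exact continuous_const

/-- Lebesgue measure on `[0, T]`. -/
abbrev intervalMeasure (T : ℝ) : Measure ℝ := volume.restrict (Set.Icc 0 T)

/-- The complex Hilbert space `L²[0, T]`. -/
abbrev L2 (T : ℝ) : Type := Lp ℂ 2 (intervalMeasure T)

/-- `t ↦ ∫_0^T ĥ(t - s) u(s) ds`. -/
def toeplitzFun (T : ℝ) (h : ℝ → ℝ) (u : ℝ → ℂ) (t : ℝ) : ℂ :=
  ∫ s in Set.Icc 0 T, hat h (t - s) * u s

lemma integrable_L2 {T : ℝ} (u : L2 T) : Integrable u (intervalMeasure T) :=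
  (Lp.memLp u).integrable (by norm_num)

lemma integrable_hat_mul {T : ℝ} (h : ℝ → ℝ) (u : L2 T) (t : ℝ) :
    Integrable (fun s => hat h (t - s) * u s) (intervalMeasure T) :=
  (integrable_L2 u).bdd_mul
    ((continuous_hat h).comp (by fun_prop)).aestronglyMeasurable
    (ae_of_all _ fun s => norm_hat_le h (t - s))

lemma norm_toeplitzFun_le {T : ℝ} (h : ℝ → ℝ) (u : L2 T) (t : ℝ) :
    ‖toeplitzFun T h u t‖ ≤ (∫ l, ‖h l‖) * ∫ s in Set.Icc 0 T, ‖u s‖ := by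
  refine (norm_integral_le_integral_norm _).trans ?_
  rw [← integral_const_mul]
  refine integral_mono (integrable_hat_mul h u t).norm ((integrable_L2 u).norm.const_mul _)
    fun s => ?_
  simp only [norm_mul]
  exact mul_le_mul_of_nonneg_right (norm_hat_le h _) (norm_nonneg _)

lemma continuous_toeplitzFun {T : ℝ} (h : ℝ → ℝ) (u : L2 T) :
    Continuous (toeplitzFun T h u) := by
  refine continuous_of_dominated (bound := fun s => (∫ l, ‖h l‖) * ‖u s‖)
    (fun t => (integrable_hat_mul h u t).1) (fun t => ae_of_all _ fun s => ?_)
    ((integrable_L2 u).norm.const_mul _) (ae_of_all _ fun s => ?_)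
  · rw [norm_mul]
    exact mul_le_mul_of_nonneg_right (norm_hat_le h _) (norm_nonneg _)
  · exact ((continuous_hat h).comp (by fun_prop)).mul continuous_const

lemma memLp_toeplitzFun {T : ℝ} (h : ℝ → ℝ) (u : L2 T) :
    MemLp (toeplitzFun T h u) 2 (intervalMeasure T) :=
  MemLp.of_bound (continuous_toeplitzFun h u).aestronglyMeasurable _
    (ae_of_all _ fun t => norm_toeplitzFun_le h u t)

lemma toeplitzFun_add {T : ℝ} (h : ℝ → ℝ) (u v : L2 T) :
    toeplitzFun T h (u + v : L2 T) = toeplitzFun T h u + toeplitzFun T h v := by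
  funext t
  simp only [toeplitzFun, Pi.add_apply]
  rw [← integral_add (integrable_hat_mul h u t) (integrable_hat_mul h v t)]
  refine integral_congr_ae ?_
  filter_upwards [Lp.coeFn_add u v] with s hs
  rw [hs, Pi.add_apply, mul_add]

lemma toeplitzFun_smul {T : ℝ} (h : ℝ → ℝ) (c : ℂ) (u : L2 T) :
    toeplitzFun T h (c • u : L2 T) = c • toeplitzFun T h u := by
  funext t
  simp only [toeplitzFun, Pi.smul_apply, smul_eq_mul]
  rw [← integral_const_mul]
  refine integral_congr_ae ?_
  filter_upwards [Lp.coeFn_smul c u] with s hs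
  rw [hs, Pi.smul_apply, smul_eq_mul, mul_left_comm]

lemma integral_norm_le (T : ℝ) :
    ∃ K : ℝ, 0 ≤ K ∧ ∀ u : L2 T, ∫ s in Set.Icc 0 T, ‖u s‖ ≤ K * ‖u‖ := by
  refine ⟨((intervalMeasure T) Set.univ ^ (1 / (1 : ℝ≥0∞).toReal - 1 / (2 : ℝ≥0∞).toReal)).toReal,
    ENNReal.toReal_nonneg, fun u => ?_⟩
  have h1 := eLpNorm_le_eLpNorm_mul_rpow_measure_univ (μ := intervalMeasure T)
    (p := 1) (q := 2) (by norm_num) (Lp.memLp u).1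
  rw [integral_norm_eq_lintegral_enorm (Lp.memLp u).1, ← eLpNorm_one_eq_lintegral_enorm,
    Lp.norm_def, mul_comm, ← ENNReal.toReal_mul]
  refine ENNReal.toReal_mono (ENNReal.mul_ne_top (Lp.memLp u).2.ne ?_) h1
  refine ENNReal.rpow_ne_top_of_nonneg (by norm_num) (measure_ne_top _ _)

lemma norm_toLp_toeplitzFun_le (T : ℝ) (h : ℝ → ℝ) :
    ∃ C : ℝ, ∀ u : L2 T, ‖(memLp_toeplitzFun h u).toLp‖ ≤ C * ‖u‖ := by
  obtain ⟨K, hK, hu⟩ := integral_norm_le T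
  refine ⟨(measureUnivNNReal (intervalMeasure T)) ^ ((2 : ℝ≥0∞).toReal)⁻¹ *
    ((∫ l, ‖h l‖) * K), fun u => ?_⟩
  have hh : 0 ≤ ∫ l, ‖h l‖ := integral_nonneg fun _ => norm_nonneg _
  rw [mul_assoc]
  refine Lp.norm_le_of_ae_bound (by positivity) ?_
  filter_upwards [(memLp_toeplitzFun h u).coeFn_toLp] with t ht
  rw [ht, mul_assoc]
  exact (norm_toeplitzFun_le h u t).trans (mul_le_mul_of_nonneg_left (hu u) hh)

/-- The `T`-truncated Toeplitz operator `W_T(h)` on `L²[0, T]`,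
`(W_T(h) u)(t) = ∫_0^T ĥ(t - s) u(s) ds`. -/
def toeplitz (T : ℝ) (h : ℝ → ℝ) : L2 T →L[ℂ] L2 T :=
  LinearMap.mkContinuousOfExistsBound
    { toFun := fun u => (memLp_toeplitzFun h u).toLp
      map_add' := fun u v => by
        rw [← MemLp.toLp_add]
        exact MemLp.toLp_congr _ _ (by rw [toeplitzFun_add])
      map_smul' := fun c u => by
        rw [RingHom.id_apply, ← MemLp.toLp_const_smul]
        exact MemLp.toLp_congr _ _ (by rw [toeplitzFun_smul]) }
    (norm_toLp_toeplitzFun_le T h)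

/-! ### The trace approximation error -/

variable {n : ℕ}

/-- The operator product `W_T(h_1) W_T(h_2) ⋯ W_T(h_m)`; here `m = n + 1` and the functions
`h_1, …, h_m` are `h 0, …, h n`. -/
def toeplitzProd (h : Fin (n + 1) → ℝ → ℝ) (T : ℝ) : L2 T →L[ℂ] L2 T :=
  (List.ofFn fun i => toeplitz T (h i)).prod

/-- `S(T) = T⁻¹ tr (W_T(h_1) ⋯ W_T(h_m))`. -/
def S (h : Fin (n + 1) → ℝ → ℝ) (T : ℝ) : ℂ :=
  (1 / (T : ℂ)) * opTrace (toeplitzProd h T)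

/-- `M = (2π)^{m-1} ∫ h_1(λ) ⋯ h_m(λ) dλ`. -/
def M (h : Fin (n + 1) → ℝ → ℝ) : ℝ :=
  (2 * Real.pi) ^ n * ∫ l : ℝ, ∏ i, h i l

/-- The error `Δ(T) = |S(T) - M|`. -/
def Delta (h : Fin (n + 1) → ℝ → ℝ) (T : ℝ) : ℝ :=
  ‖S h T - (M h : ℂ)‖

/-- `φ(u) = ∫ h_1(λ) h_2(λ - u_1) ⋯ h_m(λ - u_{m-1}) dλ`, `u ∈ ℝ^{m-1}`. -/
def phi (h : Fin (n + 1) → ℝ → ℝ) (u : Fin n → ℝ) : ℝ :=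
  ∫ l : ℝ, h 0 l * ∏ i : Fin n, h i.succ (l - u i)

/-! ### Function classes -/

/-- The class `F₁(ℝ)`: `f ∈ L¹(ℝ)` with `∫ |t| |f̂(t)| dt < ∞`. -/
def MemF1 (f : ℝ → ℝ) : Prop :=
  Integrable f ∧ Integrable fun t : ℝ => |t| * ‖hat f t‖

/-- The `L^p` modulus of continuity `ω_p(ψ, δ) = sup_{0 < h ≤ δ} ‖ψ(· + h) - ψ‖_p`. -/
def lpModulus (p : ℝ≥0∞) (ψ : ℝ → ℝ) (δ : ℝ) : ℝ≥0∞ :=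
  ⨆ h ∈ Set.Ioc 0 δ, eLpNorm (fun x => ψ (x + h) - ψ x) p volume

/-- The class `Lip(ℝ; p, γ)`: `ψ ∈ L^p(ℝ)` with `ω_p(ψ, δ) = O(δ^γ)` as `δ → 0`. -/
def MemLip (p : ℝ≥0∞) (γ : ℝ) (ψ : ℝ → ℝ) : Prop :=
  MemLp ψ p volume ∧
    ∃ C : ℝ, ∀ᶠ δ in 𝓝[>] (0 : ℝ), lpModulus p ψ δ ≤ ENNReal.ofReal (C * δ ^ γ)

end ToeplitzTrace

end

noncomputable section

namespace ToeplitzTrace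

/-! ### Exponentials in `L²[0, T]` -/

/-! Write e_λ for t ↦ e^{iλt} in L²[0,T], and m = n + 1. Inserting the integral for ĥ exhibits
W_T(h) as ∫ h(λ) ⟨e_λ, ·⟩ e_λ dλ, a superposition of rank-one operators with integrable weight
(`inner_toeplitz`). Hence W_T(h)B is of trace class for every bounded B, and its trace is ∫ h(λ)
⟨e_λ, B e_λ⟩ dλ (`opTrace_toeplitz_mul`). Everything else evaluates this integral with B =
W_T(h_2)⋯W_T(h_m).

(B1) On the whole line, convolution with ĥ multiplies e_λ by 2πh(λ), by Fourier inversion.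
Truncating to [0,T] only causes boundary errors, whose L¹ norm is at most ∫|r||ĥ(r)|dr, uniformly in
T and λ. By induction B e_λ equals (2π)^{m-1} h_2(λ)⋯h_m(λ) e_λ up to an error bounded in L¹
(`prodOp_expVec_sub`). Since ⟨e_λ,e_λ⟩ = T, the normalized trace is off by O(1/T).

(B2) Expanding B in the same way and rescaling gives S(T) = ∫ K(x) φ(x/T) dx, where K = `fejerKer n`
does not depend on T (`S_eq_integral_fejerKer`). Up to a constant, |K| is at most a cyclic product
of factors 1/(1+|x_i - x_{i+1}|), so K(1+|x|)^γ is integrable for every γ < 1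
(`integrable_fejerKer_weight`). This strict inequality is the source of the loss ε. A Hölder
condition on φ at 0 then gives S(T) = φ(0)∫K + O(T^{-γ+ε}). The mass ∫K = (2π)^n is not computed
directly: Gaussian symbols fall under both (B1) and this expansion, and comparing the two limits
determines it (`integral_fejerKer`).

(B3) follows from (B2): Hölder's inequality and a telescoping product turn L^p-smoothness of the
symbols into smoothness of φ (`exists_abs_phi_sub_le`). (B4) follows from (B3) with 1/p_i = σ_i + γ.
These reciprocals sum to 1 exactly for γ = (1-σ)/m, and a scaling argument puts h_i in the class
Lip(p_i, γ) (`memLip_of_power_bounds`). -/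

/-- The function `t ↦ e^{iλt}`. -/
def expFun (l t : ℝ) : ℂ := Complex.exp (Complex.I * l * t)

lemma norm_expFun (l t : ℝ) : ‖expFun l t‖ = 1 := by
  have : Complex.I * l * t = ((l * t : ℝ) : ℂ) * Complex.I := by push_cast; ring
  rw [expFun, this, Complex.norm_exp_ofReal_mul_I]

lemma continuous_uncurry_expFun : Continuous fun z : ℝ × ℝ => expFun z.1 z.2 := by
  unfold expFun; fun_prop

lemma continuous_expFun (l : ℝ) : Continuous (expFun l) := by
  unfold expFun; fun_prop

lemma conj_expFun (l t : ℝ) : (starRingEnd ℂ) (expFun l t) = expFun (-l) t := by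
  simp only [expFun, ← Complex.exp_conj]
  congr 1
  simp

lemma expFun_add (l m t : ℝ) : expFun (l + m) t = expFun l t * expFun m t := by
  simp only [expFun, ← Complex.exp_add]
  congr 1
  push_cast; ring

lemma expFun_sub_right (l t s : ℝ) : expFun l (t - s) = expFun l t * expFun (-l) s := by
  simp only [expFun, ← Complex.exp_add]
  congr 1
  push_cast; ring

lemma memLp_expFun (T l : ℝ) : MemLp (expFun l) 2 (intervalMeasure T) :=
  MemLp.of_bound (continuous_expFun l).aestronglyMeasurable 1
    (ae_of_all _ fun t => (norm_expFun l t).le)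

/-- The exponential `t ↦ e^{iλt}` as an element of `L²[0, T]`. -/
def expVec (T l : ℝ) : L2 T := (memLp_expFun T l).toLp

lemma coeFn_expVec (T l : ℝ) : expVec T l =ᵐ[intervalMeasure T] expFun l :=
  (memLp_expFun T l).coeFn_toLp

lemma inner_expVec_left {T : ℝ} (l : ℝ) (u : L2 T) :
    inner ℂ (expVec T l) u = ∫ s in Set.Icc 0 T, expFun (-l) s * u s := by
  rw [L2.inner_def]
  refine integral_congr_ae ?_
  filter_upwards [coeFn_expVec T l] with s hs
  rw [RCLike.inner_apply', hs, conj_expFun]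

lemma inner_expVec_right {T : ℝ} (l : ℝ) (v : L2 T) :
    inner ℂ v (expVec T l) = ∫ t in Set.Icc 0 T, (starRingEnd ℂ) (v t) * expFun l t := by
  rw [L2.inner_def]
  refine integral_congr_ae ?_
  filter_upwards [coeFn_expVec T l] with s hs
  rw [RCLike.inner_apply', hs]

lemma norm_expFun_sub_le (l m t : ℝ) : ‖expFun l t - expFun m t‖ ≤ |l - m| * |t| := by
  have : expFun l t - expFun m t =
      expFun m t * (Complex.exp (Complex.I * ((l - m) * t : ℝ)) - 1) := by
    rw [mul_sub, mul_one, sub_left_inj, expFun, expFun, ← Complex.exp_add]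
    congr 1
    push_cast; ring
  rw [this, norm_mul, norm_expFun, one_mul]
  refine Real.norm_exp_I_mul_ofReal_sub_one_le.trans ?_
  rw [Real.norm_eq_abs, abs_mul]

lemma continuous_expVec (T : ℝ) : Continuous (expVec T) := by
  refine continuous_iff_continuousAt.2 fun m => ?_
  rw [ContinuousAt, tendsto_iff_norm_sub_tendsto_zero]
  set K : ℝ := (measureUnivNNReal (intervalMeasure T)) ^ ((2 : ℝ≥0∞).toReal)⁻¹
  refine squeeze_zero (g := fun l => K * (|l - m| * |T|)) (fun _ => norm_nonneg _) (fun l => ?_) ?_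
  · refine Lp.norm_le_of_ae_bound (by positivity) ?_
    filter_upwards [Lp.coeFn_sub (expVec T l) (expVec T m), coeFn_expVec T l, coeFn_expVec T m,
      ae_restrict_mem measurableSet_Icc] with t h1 h2 h3 h4
    rw [h1, Pi.sub_apply, h2, h3]
    refine (norm_expFun_sub_le l m t).trans ?_
    exact mul_le_mul_of_nonneg_left (abs_le_abs_of_nonneg h4.1 h4.2) (abs_nonneg _)
  · have : Continuous fun l : ℝ => K * (|l - m| * |T|) := by fun_prop
    simpa using this.tendsto m

lemma norm_expVec_le (T : ℝ) : ∃ K : ℝ, 0 ≤ K ∧ ∀ l, ‖expVec T l‖ ≤ K := by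
  refine ⟨(measureUnivNNReal (intervalMeasure T)) ^ ((2 : ℝ≥0∞).toReal)⁻¹ * 1, by positivity,
    fun l => Lp.norm_le_of_ae_bound zero_le_one ?_⟩
  filter_upwards [coeFn_expVec T l] with t ht
  rw [ht, norm_expFun]

/-! ### The spectral representation of a truncated Toeplitz operator -/

lemma hat_eq (h : ℝ → ℝ) (t : ℝ) : hat h t = ∫ l, expFun l t * (h l : ℂ) := rfl

/-- Since e^{iλ(t-s)} separates into a function of t and a function of s, Fubini turns the
convolution into a superposition of exponentials. -/
lemma toeplitzFun_eq {T : ℝ} {h : ℝ → ℝ} (hh : Integrable h) (u : L2 T) (t : ℝ) :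
    toeplitzFun T h u t = ∫ l, (h l : ℂ) * expFun l t * inner ℂ (expVec T l) u := by
  have e1 : toeplitzFun T h u t =
      ∫ s in Set.Icc 0 T, ∫ l, expFun l (t - s) * ((u s) * (h l : ℂ)) := by
    refine integral_congr_ae (ae_of_all _ fun s => ?_)
    simp only [hat_eq]
    rw [← integral_mul_const]
    congr 1; funext l; ring
  rw [e1, integral_integral_swap]
  · refine integral_congr_ae (ae_of_all _ fun l => ?_)
    simp only
    rw [inner_expVec_left, ← integral_const_mul]
    congr 1; funext s
    rw [expFun_sub_right]; ring
  · refine Integrable.bdd_mul (c := 1)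
      ((integrable_L2 u).mul_prod (Integrable.ofReal (𝕜 := ℂ) hh)) ?_ ?_
    · exact (continuous_uncurry_expFun.comp
        (by fun_prop : Continuous fun z : ℝ × ℝ => (z.2, t - z.1))).aestronglyMeasurable
    · exact ae_of_all _ fun z => (norm_expFun _ _).le

lemma coeFn_toeplitz (T : ℝ) (h : ℝ → ℝ) (u : L2 T) :
    toeplitz T h u =ᵐ[intervalMeasure T] toeplitzFun T h u :=
  (memLp_toeplitzFun h u).coeFn_toLp

lemma continuous_inner_expVec {T : ℝ} (u : L2 T) :
    Continuous fun l => inner ℂ (expVec T l) u :=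
  (continuous_expVec T).inner continuous_const

lemma norm_inner_expVec_le {T : ℝ} (u : L2 T) :
    ∃ K : ℝ, 0 ≤ K ∧ ∀ l, ‖inner ℂ (expVec T l) u‖ ≤ K := by
  obtain ⟨K, hK, h⟩ := norm_expVec_le T
  exact ⟨K * ‖u‖, by positivity, fun l => (norm_inner_le_norm _ _).trans (by gcongr; exact h l)⟩

lemma integrable_mul_inner_expVec {T : ℝ} {h : ℝ → ℝ} (hh : Integrable h) (u : L2 T) :
    Integrable fun l => (h l : ℂ) * inner ℂ (expVec T l) u := by
  obtain ⟨K, hK, hb⟩ := norm_inner_expVec_le u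
  exact (Integrable.bdd_mul (c := K) (Integrable.ofReal (𝕜 := ℂ) hh)
    (continuous_inner_expVec u).aestronglyMeasurable (ae_of_all _ hb)).congr
    (ae_of_all _ fun l => mul_comm _ _)

lemma integrable_conj_L2 {T : ℝ} (v : L2 T) :
    Integrable (fun t => (starRingEnd ℂ) (v t)) (intervalMeasure T) := by
  refine (integrable_L2 v).norm.mono' ?_ (ae_of_all _ fun t => ?_)
  · exact Complex.continuous_conj.comp_aestronglyMeasurable (integrable_L2 v).1
  · simp

/-- The weak form of W_T(h) = ∫ h(λ) ⟨e_λ, ·⟩ e_λ dλ, on which all trace computations rest. -/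
lemma inner_toeplitz {T : ℝ} {h : ℝ → ℝ} (hh : Integrable h) (v u : L2 T) :
    inner ℂ v (toeplitz T h u) =
      ∫ l, (h l : ℂ) * inner ℂ v (expVec T l) * inner ℂ (expVec T l) u := by
  have e1 : inner ℂ v (toeplitz T h u) = ∫ t in Set.Icc 0 T, ∫ l,
      expFun l t * ((starRingEnd ℂ) (v t) * ((h l : ℂ) * inner ℂ (expVec T l) u)) := by
    rw [L2.inner_def]
    refine integral_congr_ae ?_
    filter_upwards [coeFn_toeplitz T h u] with t ht
    rw [RCLike.inner_apply', ht, toeplitzFun_eq hh, ← integral_const_mul]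
    congr 1; funext l; ring
  rw [e1, integral_integral_swap]
  · refine integral_congr_ae (ae_of_all _ fun l => ?_)
    simp only
    rw [inner_expVec_right, mul_assoc, mul_comm (∫ _ in _, _), ← mul_assoc, ← integral_const_mul]
    congr 1; funext s
    ring
  · refine Integrable.bdd_mul (c := 1)
      ((integrable_conj_L2 v).mul_prod (integrable_mul_inner_expVec hh u)) ?_ ?_
    · exact (continuous_uncurry_expFun.comp
        (by fun_prop : Continuous fun z : ℝ × ℝ => (z.2, z.1))).aestronglyMeasurable
    · exact ae_of_all _ fun z => (norm_expFun _ _).le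

/-! ### Trace class property and the trace -/

section Abstract

variable {H : Type*} [NormedAddCommGroup H] [InnerProductSpace ℂ H]

/-- Cauchy–Schwarz followed by Bessel's inequality for each family: a rank-one operator has trace
norm at most ‖x‖‖y‖. -/
lemma _root_.Orthonormal.sum_norm_inner_mul_norm_inner_le {ι : Type*} {e f : ι → H}
    (he : Orthonormal ℂ e) (hf : Orthonormal ℂ f) (x y : H) (s : Finset ι) :
    ∑ k ∈ s, ‖inner ℂ (f k) x‖ * ‖inner ℂ y (e k)‖ ≤ ‖x‖ * ‖y‖ := by
  have h1 := hf.sum_inner_products_le (s := s) x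
  have h2 := he.sum_inner_products_le (s := s) y
  have h3 := Finset.sum_mul_sq_le_sq_mul_sq s (fun k => ‖inner ℂ (f k) x‖)
    (fun k => ‖inner ℂ y (e k)‖)
  simp only [norm_inner_symm y] at h3 ⊢
  refine abs_le_of_sq_le_sq' ?_ (by positivity) |>.2
  refine h3.trans ?_
  rw [mul_pow]
  gcongr

/-- Distinct members lie at distance √2, so balls of radius 1/2 around them are disjoint.
Countability is what permits exchanging the trace sum with an integral. -/
lemma _root_.Orthonormal.countable [TopologicalSpace.SeparableSpace H] {ι : Type*} {e : ι → H}
    (he : Orthonormal ℂ e) : Countable ι := by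
  have hd : (Set.univ : Set ι).PairwiseDisjoint fun i => Metric.ball (e i) (1 / 2) := by
    intro i _ j _ hij
    refine Metric.ball_disjoint_ball ?_
    have h1 : ‖e i - e j‖ ^ 2 = 2 := by
      rw [@norm_sub_sq ℂ, he.2 hij, he.1, he.1]
      norm_num
    rw [dist_eq_norm]
    nlinarith [norm_nonneg (e i - e j)]
  exact Set.countable_univ_iff.1 (hd.countable_of_isOpen (fun i _ => Metric.isOpen_ball)
    fun i _ => ⟨e i, Metric.mem_ball_self (by norm_num)⟩)

end Abstract

section Trace

variable {T : ℝ} {h : ℝ → ℝ}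

lemma integrable_mul_inner_mul_inner (hh : Integrable h) (v u : L2 T) :
    Integrable fun l => (h l : ℂ) * inner ℂ v (expVec T l) * inner ℂ (expVec T l) u := by
  obtain ⟨K, hK, hb⟩ := norm_inner_expVec_le v
  refine ((integrable_mul_inner_expVec hh u).bdd_mul (c := K)
    (f := fun l => inner ℂ v (expVec T l)) ?_ (ae_of_all _ fun l => ?_)).congr
    (ae_of_all _ fun l => ?_)
  · exact (continuous_const.inner (continuous_expVec T)).aestronglyMeasurable
  · rw [norm_inner_symm]; exact hb l
  · simp only; ring

/-- Moving B onto e_λ through its adjoint lets the rank-one bound apply under the integral. The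
index type is left free so that sequences and the fixed orthonormal basis are both covered. -/
lemma sum_integral_norm_le (hh : Integrable h) (B : L2 T →L[ℂ] L2 T) :
    ∃ K : ℝ, ∀ (ι : Type) (e f : ι → L2 T), Orthonormal ℂ e → Orthonormal ℂ f → ∀ s : Finset ι,
      ∑ k ∈ s, ∫ l, ‖(h l : ℂ) * inner ℂ (f k) (expVec T l) * inner ℂ (expVec T l) (B (e k))‖
        ≤ K := by
  obtain ⟨K, hK, hb⟩ := norm_expVec_le T
  refine ⟨∫ l, ‖h l‖ * (K * (‖ContinuousLinearMap.adjoint B‖ * K)), fun ι e f he hf s => ?_⟩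
  rw [← integral_finsetSum _ fun k _ => (integrable_mul_inner_mul_inner hh _ _).norm]
  refine integral_mono (integrable_finsetSum _ fun k _ =>
    (integrable_mul_inner_mul_inner hh _ _).norm) (hh.norm.mul_const _) fun l => ?_
  simp only [norm_mul, Complex.norm_real, mul_assoc, ← Finset.mul_sum,
    ← ContinuousLinearMap.adjoint_inner_left]
  refine mul_le_mul_of_nonneg_left ?_ (norm_nonneg _)
  refine (he.sum_norm_inner_mul_norm_inner_le hf _ _ s).trans ?_
  gcongr
  · exact hb l
  · exact (ContinuousLinearMap.le_opNorm _ _).trans (by gcongr; exact hb l)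

lemma isTraceClass_toeplitz_mul (hh : Integrable h) (B : L2 T →L[ℂ] L2 T) :
    IsTraceClass (toeplitz T h * B) := by
  intro e f he hf
  obtain ⟨K, hK⟩ := sum_integral_norm_le hh B
  refine summable_of_sum_le (c := K) (fun _ => norm_nonneg _) fun s => ?_
  refine (Finset.sum_le_sum fun k _ => ?_).trans (hK ℕ e f he hf s)
  rw [mul_apply_eq_comp, inner_toeplitz hh]
  exact norm_integral_le_integral_norm _

/-- The uniform bound justifies summing under the integral, where Parseval collapses the sum over
the basis. -/
lemma opTrace_toeplitz_mul (hh : Integrable h) (B : L2 T →L[ℂ] L2 T) :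
    opTrace (toeplitz T h * B) = ∫ l, (h l : ℂ) * inner ℂ (expVec T l) (B (expVec T l)) := by
  -- This makes the separability of L² available to instance search.
  have : Fact ((2 : ℝ≥0∞) ≠ ∞) := ⟨by norm_num⟩
  have : Countable (onbIndex (L2 T)) := (onb (L2 T)).orthonormal.countable
  have ho := (onb (L2 T)).orthonormal
  obtain ⟨K, hK⟩ := sum_integral_norm_le hh B
  have key := hasSum_integral_of_summable_integral_norm
    (fun i : onbIndex (L2 T) => integrable_mul_inner_mul_inner hh (onb (L2 T) i)
      (B (onb (L2 T) i)))
    (summable_of_sum_le (c := K) (fun _ => integral_nonneg fun _ => norm_nonneg _)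
      fun s => hK _ _ _ ho ho s)
  rw [opTrace]
  simp only [mul_apply_eq_comp, inner_toeplitz hh]
  rw [key.tsum_eq]
  congr 1; funext l
  have h2 := (onb (L2 T)).hasSum_inner_mul_inner
    (ContinuousLinearMap.adjoint B (expVec T l)) (expVec T l)
  rw [ContinuousLinearMap.adjoint_inner_left] at h2
  rw [← (h2.mul_left (h l : ℂ)).tsum_eq]
  congr 1; funext i
  rw [ContinuousLinearMap.adjoint_inner_left]; ring

end Trace

/-! ### Fourier inversion almost everywhere -/

section Inversion

open FourierTransform

lemma integral_fourier_mul_eq_flip {f g : ℝ → ℂ} (hf : Integrable f) (hg : Integrable g) :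
    ∫ x, 𝓕 f x * g x = ∫ x, f x * 𝓕 g x := by
  simpa using! VectorFourier.integral_fourierIntegral_smul_eq_flip (L := innerₗ ℝ)
    Real.continuous_fourierChar continuous_inner hf hg

lemma continuous_fourier {f : ℝ → ℂ} (hf : Integrable f) : Continuous (𝓕 f) :=
  VectorFourier.fourierIntegral_continuous (L := innerₗ ℝ)
    Real.continuous_fourierChar continuous_inner hf

/-- Continuity of f is not available, so both sides are tested against smooth compactly supported g.
Such g are Schwartz functions, for which inversion is known, and it passes to f by the symmetry ∫
𝓕f·g = ∫ f·𝓕g. -/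
lemma ae_eq_fourierInv_fourier {f : ℝ → ℂ} (hf : Integrable f) (hf' : Integrable (𝓕 f)) :
    f =ᵐ[volume] 𝓕⁻ (𝓕 f) := by
  refine ae_eq_of_integral_contDiff_smul_eq hf.locallyIntegrable ?_ fun g hg hc => ?_
  · rw [Real.fourierInv_eq_fourier_comp_neg]
    exact (continuous_fourier hf'.comp_neg).locallyIntegrable
  · have hc' : HasCompactSupport fun x => (g x : ℂ) := hc.comp_left Complex.ofReal_zero
    have hg' : ContDiff ℝ ((⊤ : ℕ∞) : WithTop ℕ∞) fun x => (g x : ℂ) :=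
      Complex.ofRealCLM.contDiff.comp hg
    set G : SchwartzMap ℝ ℂ := hc'.toSchwartzMap hg' with hG
    have hGc : ∀ x, G x = (g x : ℂ) := fun x => rfl
    have hGG : ∀ x, 𝓕 (𝓕⁻ G : SchwartzMap ℝ ℂ) x = G x := fun x => by
      rw [FourierTransform.fourier_fourierInv_eq]
    have e1 : ∫ x, g x • f x = ∫ x, (𝓕⁻ G : SchwartzMap ℝ ℂ) x * 𝓕 f x := by
      rw [← integral_fourier_mul_eq_flip (𝓕⁻ G : SchwartzMap ℝ ℂ).integrable hf,
        ← SchwartzMap.fourier_coe]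
      congr 1; funext x
      rw [hGG, hGc, Complex.real_smul]
    have e2 : ∫ x, g x • 𝓕⁻ (𝓕 f) x = ∫ x, 𝓕 f x * 𝓕 G (-x) := by
      simp only [Real.fourierInv_eq_fourier_comp_neg, Complex.real_smul, ← hGc]
      have h3 := integral_fourier_mul_eq_flip G.integrable hf'.comp_neg
      rw [← h3, ← integral_neg_eq_self]
      congr 1; funext x
      rw [neg_neg, mul_comm, SchwartzMap.fourier_coe]
    rw [e1, e2]
    congr 1; funext x
    rw [mul_comm, SchwartzMap.fourierInv_coe, Real.fourierInv_eq_fourier_neg,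
      SchwartzMap.fourier_coe]

lemma fourier_ofReal_eq_hat (h : ℝ → ℝ) :
    𝓕 (fun x => (h x : ℂ)) = fun w => hat h (-(2 * Real.pi) * w) := by
  funext w
  rw [Real.fourier_real_eq_integral_exp_smul, hat]
  congr 1; funext v
  rw [smul_eq_mul]
  congr 2
  push_cast; ring

lemma ae_inversion {h : ℝ → ℝ} (hh : Integrable h) (hi : Integrable (hat h)) :
    ∀ᵐ l : ℝ, ∫ r, expFun (-l) r * hat h r = (2 * Real.pi : ℂ) * (h l : ℂ) := by
  have hpi : -(2 * Real.pi) ≠ 0 := by have := Real.pi_pos; linarith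
  have h1 : Integrable (𝓕 fun x => (h x : ℂ)) := by
    rw [fourier_ofReal_eq_hat]
    exact hi.comp_mul_left' hpi
  filter_upwards [ae_eq_fourierInv_fourier (Integrable.ofReal (𝕜 := ℂ) hh) h1] with l hl
  have h2 := Measure.integral_comp_mul_left (fun r => expFun (-l) r * hat h r) (-(2 * Real.pi))
  have h3 : 𝓕⁻ (𝓕 fun x => (h x : ℂ)) l =
      ∫ v : ℝ, expFun (-l) (-(2 * Real.pi) * v) * hat h (-(2 * Real.pi) * v) := by
    rw [fourier_ofReal_eq_hat, Real.fourierInv_eq']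
    congr 1; funext v
    rw [smul_eq_mul, expFun]
    congr 2
    simp only [RCLike.inner_apply, conj_trivial]
    push_cast; ring
  rw [← h3] at h2
  have hl' : (h l : ℂ) = _ := hl.trans h2
  rw [hl', inv_neg, abs_neg, abs_of_pos (by have := Real.pi_pos; positivity), Complex.real_smul]
  have : (Real.pi : ℂ) ≠ 0 := by exact_mod_cast Real.pi_pos.ne'
  push_cast
  field_simp

end Inversion

/-- The transform is bounded by ‖h‖₁ on [-1,1] and dominated by |t||ĥ(t)| outside. -/
lemma MemF1.integrable_hat {h : ℝ → ℝ} (hh : MemF1 h) : Integrable (hat h) := by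
  have h1 : Integrable ((Set.Icc (-1 : ℝ) 1).indicator fun _ => ∫ l, ‖h l‖) :=
    (integrable_indicator_iff measurableSet_Icc).2 (integrableOn_const (by simp))
  refine (h1.add hh.2).mono' (continuous_hat h).aestronglyMeasurable (ae_of_all _ fun t => ?_)
  by_cases ht : t ∈ Set.Icc (-1 : ℝ) 1
  · rw [Pi.add_apply, Set.indicator_of_mem ht]
    have := norm_hat_le h t
    have : 0 ≤ |t| * ‖hat h t‖ := by positivity
    linarith
  · rw [Pi.add_apply, Set.indicator_of_notMem ht, zero_add]
    have : 1 ≤ |t| := by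
      by_contra! hlt
      exact ht (Set.mem_Icc.2 (abs_le.1 hlt.le))
    exact le_mul_of_one_le_left (norm_nonneg _) this

/-! ### Estimates in `L¹[0, T]` -/

/-- The `L¹` norm of an element of `L²[0, T]`. -/
def l1 {T : ℝ} (v : L2 T) : ℝ≥0∞ := ∫⁻ t in Set.Icc 0 T, ‖v t‖ₑ

lemma l1_eq_eLpNorm {T : ℝ} (v : L2 T) : l1 v = eLpNorm v 1 (intervalMeasure T) :=
  eLpNorm_one_eq_lintegral_enorm.symm

lemma l1_add_le {T : ℝ} (u v : L2 T) : l1 (u + v) ≤ l1 u + l1 v := by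
  simp only [l1_eq_eLpNorm]
  rw [eLpNorm_congr_ae (Lp.coeFn_add u v)]
  exact eLpNorm_add_le (Lp.aestronglyMeasurable u) (Lp.aestronglyMeasurable v) le_rfl

lemma l1_smul {T : ℝ} (c : ℂ) (v : L2 T) : l1 (c • v) = ‖c‖ₑ * l1 v := by
  simp only [l1_eq_eLpNorm]
  rw [eLpNorm_congr_ae (Lp.coeFn_smul c v), eLpNorm_const_smul]

lemma enorm_expFun (l t : ℝ) : ‖expFun l t‖ₑ = 1 := by
  rw [← ofReal_norm, norm_expFun, ENNReal.ofReal_one]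

/-- The reason for measuring errors in L¹: exponentials have modulus one, so no power of T is lost,
whereas Cauchy–Schwarz in L² would cost √T. -/
lemma enorm_inner_expVec_le {T : ℝ} (l : ℝ) (v : L2 T) : ‖inner ℂ (expVec T l) v‖ₑ ≤ l1 v := by
  rw [inner_expVec_left]
  refine (enorm_integral_le_lintegral_enorm _).trans (le_of_eq ?_)
  simp only [enorm_mul, enorm_expFun, one_mul, l1]

/-- Young's inequality for a truncated convolution; the constant is independent of T. -/
lemma l1_toeplitz_le {T : ℝ} (h : ℝ → ℝ) (v : L2 T) :
    l1 (toeplitz T h v) ≤ (∫⁻ t, ‖hat h t‖ₑ) * l1 v := by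
  have hm : Measurable fun t => ‖hat h t‖ₑ := (continuous_hat h).measurable.enorm
  calc l1 (toeplitz T h v) = ∫⁻ t in Set.Icc 0 T, ‖toeplitzFun T h v t‖ₑ := by
        refine lintegral_congr_ae ?_
        filter_upwards [coeFn_toeplitz T h v] with t ht
        rw [ht]
    _ ≤ ∫⁻ t in Set.Icc 0 T, ∫⁻ s in Set.Icc 0 T, ‖hat h (t - s)‖ₑ * ‖v s‖ₑ := by
        refine lintegral_mono fun t => (enorm_integral_le_lintegral_enorm _).trans (le_of_eq ?_)
        simp only [enorm_mul]
    _ = ∫⁻ s in Set.Icc 0 T, ∫⁻ t in Set.Icc 0 T, ‖hat h (t - s)‖ₑ * ‖v s‖ₑ := by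
        refine lintegral_lintegral_swap ?_
        refine (hm.comp (measurable_fst.sub measurable_snd)).aemeasurable.mul ?_
        exact (Lp.aestronglyMeasurable v).enorm.comp_snd
    _ ≤ ∫⁻ s in Set.Icc 0 T, (∫⁻ t, ‖hat h t‖ₑ) * ‖v s‖ₑ := by
        refine lintegral_mono fun s => ?_
        rw [lintegral_mul_const _ (by exact hm.comp (measurable_id.sub_const s))]
        refine mul_le_mul' ((setLIntegral_le_lintegral _ _).trans (le_of_eq ?_)) le_rfl
        exact lintegral_sub_right_eq_self (fun t => ‖hat h t‖ₑ) s
    _ = (∫⁻ t, ‖hat h t‖ₑ) * l1 v := by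
        rw [lintegral_const_mul'' _ (Lp.aestronglyMeasurable v).enorm, l1]

lemma volume_exit_le (T r : ℝ) :
    volume {t | t ∈ Set.Icc 0 T ∧ t - r ∉ Set.Icc 0 T} ≤ ENNReal.ofReal |r| := by
  rcases le_total 0 r with hr | hr
  · refine (measure_mono (t := Set.Ico 0 r) ?_).trans (by simp [abs_of_nonneg hr])
    rintro t ⟨ht, ht'⟩
    refine ⟨ht.1, ?_⟩
    by_contra! hc
    exact ht' ⟨by linarith, by linarith [ht.2]⟩
  · refine (measure_mono (t := Set.Ioc (T + r) T) ?_).trans (by simp [abs_of_nonpos hr])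
    rintro t ⟨ht, ht'⟩
    refine ⟨?_, ht.2⟩
    by_contra! hc
    exact ht' ⟨by linarith [ht.1], by linarith⟩

/-- Substitute s = t - r and apply Tonelli: for fixed r, the points t of [0,T] with t - r outside
fill a strip at one end, of length at most |r|. -/
lemma lintegral_exit_le {f : ℝ → ℝ≥0∞} (hf : Measurable f) (T : ℝ) :
    ∫⁻ t in Set.Icc 0 T, ∫⁻ s in (Set.Icc 0 T)ᶜ, f (t - s) ≤
      ∫⁻ r, ENNReal.ofReal |r| * f r := by
  set E : Set (ℝ × ℝ) := {z | z.1 ∈ Set.Icc 0 T ∧ z.1 - z.2 ∉ Set.Icc 0 T} with hE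
  have hEm : MeasurableSet E :=
    (measurableSet_Icc.preimage measurable_fst).inter
      (measurableSet_Icc.preimage (measurable_fst.sub measurable_snd)).compl
  calc ∫⁻ t in Set.Icc 0 T, ∫⁻ s in (Set.Icc 0 T)ᶜ, f (t - s)
      = ∫⁻ t, ∫⁻ r, E.indicator (fun z => f z.2) (t, r) := by
        rw [← lintegral_indicator measurableSet_Icc]
        refine lintegral_congr fun t => ?_
        by_cases ht : t ∈ Set.Icc 0 T
        · rw [Set.indicator_of_mem ht, ← lintegral_indicator measurableSet_Icc.compl,
            ← lintegral_sub_left_eq_self _ t]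
          refine lintegral_congr fun r => ?_
          by_cases hr : t - r ∈ Set.Icc 0 T
          · rw [Set.indicator_of_notMem (by simpa using! hr),
              Set.indicator_of_notMem (fun hc : (t, r) ∈ E => hc.2 hr)]
          · rw [Set.indicator_of_mem (by simpa using! hr),
              Set.indicator_of_mem (show (t, r) ∈ E from ⟨ht, hr⟩), sub_sub_cancel]
        · rw [Set.indicator_of_notMem ht]
          symm
          refine (lintegral_congr fun r => ?_).trans lintegral_zero
          exact Set.indicator_of_notMem (fun hc : (t, r) ∈ E => ht hc.1) _
    _ = ∫⁻ r, ∫⁻ t, E.indicator (fun z => f z.2) (t, r) :=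
        lintegral_lintegral_swap ((hf.comp measurable_snd).indicator hEm).aemeasurable
    _ ≤ ∫⁻ r, ENNReal.ofReal |r| * f r := by
        refine lintegral_mono fun r => ?_
        have hm : MeasurableSet {t | t ∈ Set.Icc 0 T ∧ t - r ∉ Set.Icc 0 T} :=
          hEm.preimage (measurable_id.prodMk measurable_const)
        have : (fun t => E.indicator (fun z => f z.2) (t, r)) =
            {t | t ∈ Set.Icc 0 T ∧ t - r ∉ Set.Icc 0 T}.indicator fun _ => f r := by
          funext t
          simp only [Set.indicator, hE, Set.mem_ofPred_eq]
        rw [this, lintegral_indicator_const hm, mul_comm]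
        gcongr
        exact volume_exit_le T r

/-- Convolution with ĥ over all of ℝ has e^{iλt} as an eigenfunction with eigenvalue c, so the
defect is exactly the integral over s outside [0,T]. -/
lemma toeplitz_expVec_sub {h : ℝ → ℝ} (hi : Integrable (hat h)) {l : ℝ} {c : ℂ}
    (hl : ∫ r, expFun (-l) r * hat h r = c) (T : ℝ) :
    l1 (toeplitz T h (expVec T l) - c • expVec T l) ≤
      ∫⁻ r, ENNReal.ofReal |r| * ‖hat h r‖ₑ := by
  refine le_trans ?_ (lintegral_exit_le (continuous_hat h).measurable.enorm T)
  refine lintegral_mono_ae ?_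
  filter_upwards [Lp.coeFn_sub (toeplitz T h (expVec T l)) (c • expVec T l),
    Lp.coeFn_smul c (expVec T l), coeFn_toeplitz T h (expVec T l), coeFn_expVec T l]
    with t h1 h2 h3 h4
  have hint : Integrable fun s => hat h (t - s) * expFun l s :=
    ((hi.comp_sub_left t).bdd_mul (c := 1) (continuous_expFun l).aestronglyMeasurable
      (ae_of_all _ fun s => (norm_expFun l s).le)).congr (ae_of_all _ fun s => mul_comm _ _)
  have h5 : toeplitzFun T h (expVec T l) t = ∫ s in Set.Icc 0 T, hat h (t - s) * expFun l s := by
    refine integral_congr_ae ?_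
    filter_upwards [coeFn_expVec T l] with s hs
    rw [hs]
  have h6 : c * expFun l t = ∫ s, hat h (t - s) * expFun l s := by
    rw [← hl, ← integral_mul_const, ← integral_sub_left_eq_self _ volume t]
    congr 1; funext s
    rw [expFun_sub_right, neg_neg]
    have : expFun (-l) t * expFun l t = 1 := by
      rw [← expFun_add, neg_add_cancel]; simp [expFun]
    linear_combination (hat h (t - s) * expFun l s) * this
  have h7 := integral_add_compl (measurableSet_Icc : MeasurableSet (Set.Icc 0 T)) hint
  rw [h1, Pi.sub_apply, h2, Pi.smul_apply, h3, h4, smul_eq_mul, h5, h6, ← h7, sub_add_cancel_left,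
    enorm_neg]
  refine (enorm_integral_le_lintegral_enorm _).trans (le_of_eq ?_)
  refine lintegral_congr fun s => ?_
  rw [enorm_mul, enorm_expFun, mul_one]

/-! ### Products of Toeplitz operators on exponentials, and symbols of class F₁. -/

/-- The product `W_T(h_1) ⋯ W_T(h_n)`. -/
def prodOp {n : ℕ} (h : Fin n → ℝ → ℝ) (T : ℝ) : L2 T →L[ℂ] L2 T :=
  (List.ofFn fun i => toeplitz T (h i)).prod

lemma prodOp_succ {n : ℕ} (h : Fin (n + 1) → ℝ → ℝ) (T : ℝ) :
    prodOp h T = toeplitz T (h 0) * prodOp (fun i => h i.succ) T := by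
  simp only [prodOp, List.ofFn_succ, List.prod_cons]

lemma prodOp_zero (h : Fin 0 → ℝ → ℝ) (T : ℝ) : prodOp h T = 1 := by
  simp [prodOp]

lemma toeplitzProd_eq {n : ℕ} (h : Fin (n + 1) → ℝ → ℝ) (T : ℝ) :
    toeplitzProd h T = toeplitz T (h 0) * prodOp (fun i => h i.succ) T :=
  prodOp_succ h T

lemma lintegral_enorm_hat_lt_top {h : ℝ → ℝ} (hh : MemF1 h) : ∫⁻ t, ‖hat h t‖ₑ < ∞ :=
  hh.integrable_hat.2

lemma lintegral_abs_mul_enorm_hat_lt_top {h : ℝ → ℝ} (hh : MemF1 h) :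
    ∫⁻ t, ENNReal.ofReal |t| * ‖hat h t‖ₑ < ∞ := by
  refine lt_of_eq_of_lt ?_ hh.2.2
  refine lintegral_congr fun t => ?_
  rw [enorm_mul, ← ofReal_norm |t|, enorm_norm, Real.norm_eq_abs, abs_abs]

/-- Induction peeling off the leftmost operator W: W(Be - c'e) + c'(We - c₀e) bounds the new error
by the old one plus one boundary error. K is carried along to control c', using |2πh(λ)| ≤ ‖ĥ‖₁
almost everywhere. -/
lemma prodOp_expVec_sub {n : ℕ} (h : Fin n → ℝ → ℝ) (hh : ∀ i, MemF1 (h i)) :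
    ∃ C K : ℝ≥0∞, C < ∞ ∧ K < ∞ ∧ ∀ᵐ l : ℝ, ‖∏ i, (2 * Real.pi * h i l : ℂ)‖ₑ ≤ K ∧ ∀ T : ℝ,
      l1 (prodOp h T (expVec T l) - (∏ i, (2 * Real.pi * h i l : ℂ)) • expVec T l) ≤ C := by
  induction n with
  | zero =>
    refine ⟨0, 1, by simp, by simp, ae_of_all _ fun l => ⟨by simp, fun T => ?_⟩⟩
    have := l1_smul (0 : ℂ) (expVec T l)
    simpa [prodOp_zero] using this
  | succ n ih =>
    obtain ⟨C, K, hC, hK, hb⟩ := ih (fun i => h i.succ) fun i => hh i.succ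
    refine ⟨(∫⁻ t, ‖hat (h 0) t‖ₑ) * C + K * ∫⁻ t, ENNReal.ofReal |t| * ‖hat (h 0) t‖ₑ,
      (∫⁻ t, ‖hat (h 0) t‖ₑ) * K,
      ENNReal.add_lt_top.2 ⟨ENNReal.mul_lt_top (lintegral_enorm_hat_lt_top (hh 0)) hC,
        ENNReal.mul_lt_top hK (lintegral_abs_mul_enorm_hat_lt_top (hh 0))⟩,
      ENNReal.mul_lt_top (lintegral_enorm_hat_lt_top (hh 0)) hK, ?_⟩
    filter_upwards [hb, ae_inversion (hh 0).1 (hh 0).integrable_hat] with l hl hl0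
    refine ⟨?_, fun T => ?_⟩
    · rw [Fin.prod_univ_succ, enorm_mul, ← hl0]
      refine mul_le_mul' ((enorm_integral_le_lintegral_enorm _).trans (le_of_eq ?_)) hl.1
      refine lintegral_congr fun s => ?_
      rw [enorm_mul, enorm_expFun, one_mul]
    · set c' : ℂ := ∏ i : Fin n, (2 * Real.pi * h i.succ l : ℂ) with hc'
      set B := prodOp (fun i => h i.succ) T
      have e : prodOp h T (expVec T l) - (∏ i, (2 * Real.pi * h i l : ℂ)) • expVec T l =
          toeplitz T (h 0) (B (expVec T l) - c' • expVec T l) + c' •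
            (toeplitz T (h 0) (expVec T l) - (2 * Real.pi * h 0 l : ℂ) • expVec T l) := by
        rw [prodOp_succ, mul_apply_eq_comp, Fin.prod_univ_succ, ← hc', map_sub, map_smul,
          smul_sub, smul_smul, mul_comm c']
        abel
      rw [e]
      refine (l1_add_le _ _).trans (add_le_add ?_ ?_)
      · refine (l1_toeplitz_le _ _).trans ?_
        gcongr
        exact hl.2 T
      · rw [l1_smul]
        exact mul_le_mul' hl.1 (toeplitz_expVec_sub (hh 0).integrable_hat hl0 T)

lemma inner_expVec_self {T : ℝ} (hT : 0 ≤ T) (l : ℝ) :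
    inner ℂ (expVec T l) (expVec T l) = (T : ℂ) := by
  have : inner ℂ (expVec T l) (expVec T l) = ∫ _ in Set.Icc 0 T, (1 : ℂ) := by
    rw [inner_expVec_left]
    refine integral_congr_ae ?_
    filter_upwards [coeFn_expVec T l] with t ht
    rw [ht, ← expFun_add, neg_add_cancel]; simp [expFun]
  rw [this]
  simp [hT]

lemma S_eq {n : ℕ} {h : Fin (n + 1) → ℝ → ℝ} (h0 : Integrable (h 0)) (T : ℝ) :
    S h T = (1 / (T : ℂ)) * ∫ l, (h 0 l : ℂ) *
      inner ℂ (expVec T l) (prodOp (fun i => h i.succ) T (expVec T l)) := by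
  rw [S, toeplitzProd_eq, opTrace_toeplitz_mul h0]

lemma integrable_inner_expVec_apply {T : ℝ} {f : ℝ → ℝ} (hf : Integrable f)
    (B : L2 T →L[ℂ] L2 T) :
    Integrable fun l => (f l : ℂ) * inner ℂ (expVec T l) (B (expVec T l)) := by
  obtain ⟨K, hK, hb⟩ := norm_expVec_le T
  refine (Integrable.bdd_mul (c := K * (‖B‖ * K)) (Integrable.ofReal (𝕜 := ℂ) hf)
    (f := fun l => inner ℂ (expVec T l) (B (expVec T l))) ?_
    (ae_of_all _ fun l => ?_)).congr (ae_of_all _ fun l => mul_comm _ _)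
  · exact ((continuous_expVec T).inner
      (B.continuous.comp (continuous_expVec T))).aestronglyMeasurable
  · refine (norm_inner_le_norm _ _).trans ?_
    gcongr
    · exact hb l
    · exact (B.le_opNorm _).trans (by gcongr; exact hb l)

/-- The trace approximation for symbols of class `F₁`. -/
theorem trace_approximation_of_memF1 {n : ℕ} (h : Fin (n + 1) → ℝ → ℝ) (hh : ∀ i, MemF1 (h i)) :
    Integrable (fun l => ∏ i, h i l) ∧
      (fun T : ℝ => Delta h T) =O[atTop] fun T : ℝ => T ^ (-1 : ℝ) := by
  have hpi := Real.pi_pos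
  obtain ⟨C, K, hC, hK, hb⟩ := prodOp_expVec_sub (fun i => h (Fin.succ i)) fun i => hh i.succ
  set p : ℝ → ℂ := fun l => ∏ i : Fin n, (2 * Real.pi * h i.succ l : ℂ) with hp
  have hpe : ∀ l, p l = (((2 * Real.pi) ^ n * ∏ i : Fin n, h i.succ l : ℝ) : ℂ) := fun l => by
    simp only [hp]
    push_cast
    rw [Finset.prod_mul_distrib]
    simp
  have hp0 : Integrable fun l => (h 0 l : ℂ) * p l := by
    refine (Integrable.bdd_mul (c := K.toReal) (Integrable.ofReal (𝕜 := ℂ) (hh 0).1)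
      (f := p) ?_ ?_).congr (ae_of_all _ fun l => mul_comm _ _)
    · exact Finset.aestronglyMeasurable_fun_prod _ fun i _ => aestronglyMeasurable_const.mul
        (Complex.continuous_ofReal.comp_aestronglyMeasurable (hh i.succ).1.1)
    · filter_upwards [hb] with l hl
      rw [← toReal_enorm]
      exact ENNReal.toReal_mono hK.ne hl.1
  have hpm : ∀ l, (h 0 l : ℂ) * p l = (((2 * Real.pi) ^ n * ∏ i, h i l : ℝ) : ℂ) := fun l => by
    rw [hpe, Fin.prod_univ_succ]
    push_cast; ring
  refine ⟨?_, ?_⟩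
  · have h1 : Integrable fun l => (2 * Real.pi) ^ n * ∏ i, h i l := by
      refine hp0.re.congr (ae_of_all _ fun l => ?_)
      simp only [hpm]
      exact Complex.ofReal_re _
    refine (h1.const_mul ((2 * Real.pi) ^ n)⁻¹).congr (ae_of_all _ fun l => ?_)
    simp only
    rw [inv_mul_cancel_left₀ (by positivity)]
  · refine IsBigO.of_bound ((∫ l, ‖h 0 l‖) * C.toReal) ?_
    filter_upwards [eventually_gt_atTop 0] with T hT
    have hTc : (T : ℂ) ≠ 0 := by exact_mod_cast hT.ne'
    have hM : (M h : ℂ) = (1 / (T : ℂ)) * ∫ l, (h 0 l : ℂ) *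
        inner ℂ (expVec T l) (p l • expVec T l) := by
      have : ∀ l, (h 0 l : ℂ) * inner ℂ (expVec T l) (p l • expVec T l) =
          (((2 * Real.pi) ^ n * ∏ i, h i l : ℝ) : ℂ) * T := fun l => by
        rw [inner_smul_right, inner_expVec_self hT.le, ← mul_assoc, hpm]
      simp only [this]
      rw [integral_mul_const, integral_complex_ofReal, integral_const_mul, M]
      field_simp
    have hi2 : Integrable fun l => (h 0 l : ℂ) * inner ℂ (expVec T l) (p l • expVec T l) := by
      refine (hp0.mul_const (T : ℂ)).congr (ae_of_all _ fun l => ?_)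
      simp only
      rw [inner_smul_right, inner_expVec_self hT.le, mul_assoc]
    have hb' : ‖∫ l, ((h 0 l : ℂ) *
        inner ℂ (expVec T l) (prodOp (fun i => h i.succ) T (expVec T l)) -
        (h 0 l : ℂ) * inner ℂ (expVec T l) (p l • expVec T l))‖ ≤ (∫ l, ‖h 0 l‖) * C.toReal := by
      rw [← integral_mul_const]
      refine norm_integral_le_of_norm_le ((hh 0).1.norm.mul_const _) ?_
      filter_upwards [hb] with l hl
      rw [← mul_sub, ← inner_sub_right, norm_mul, Complex.norm_real]
      refine mul_le_mul_of_nonneg_left ?_ (norm_nonneg _)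
      rw [← toReal_enorm]
      exact ENNReal.toReal_mono hC.ne ((enorm_inner_expVec_le _ _).trans (hl.2 T))
    rw [Delta, S_eq (hh 0).1, hM, ← mul_sub,
      ← integral_sub (integrable_inner_expVec_apply (hh 0).1 _) hi2, norm_norm, norm_mul,
      Real.rpow_neg_one, norm_inv, Real.norm_of_nonneg hT.le, mul_comm]
    gcongr
    rw [norm_div, norm_one, Complex.norm_real, Real.norm_of_nonneg hT.le, one_div]

/-! ### The kernel of the trace -/

/-- The kernel `∫_0^T e^{-ixt} dt`. -/
def stepKer (T x : ℝ) : ℂ := ∫ t in Set.Icc 0 T, expFun (-x) t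

lemma inner_expVec_expVec (T l m : ℝ) :
    inner ℂ (expVec T l) (expVec T m) = stepKer T (l - m) := by
  rw [inner_expVec_left, stepKer]
  refine integral_congr_ae ?_
  filter_upwards [coeFn_expVec T m] with t ht
  rw [ht, ← expFun_add]
  congr 1; ring

lemma continuous_stepKer (T : ℝ) : Continuous (stepKer T) := by
  have : stepKer T = fun x => inner ℂ (expVec T x) (expVec T 0) := by
    funext x
    rw [inner_expVec_expVec, sub_zero]
  rw [this]
  exact continuous_inner_expVec _

lemma norm_stepKer_le {T : ℝ} (hT : 0 ≤ T) (x : ℝ) : ‖stepKer T x‖ ≤ T := by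
  refine (norm_integral_le_integral_norm _).trans (le_of_eq ?_)
  simp [norm_expFun, hT]

lemma stepKer_eq_intervalIntegral {T : ℝ} (hT : 0 ≤ T) (x : ℝ) :
    stepKer T x = ∫ t in (0 : ℝ)..T, expFun (-x) t := by
  rw [stepKer, integral_Icc_eq_integral_Ioc, intervalIntegral.integral_of_le hT]

lemma stepKer_scale {T : ℝ} (hT : 0 < T) (x : ℝ) : stepKer T x = T * stepKer 1 (T * x) := by
  rw [stepKer_eq_intervalIntegral hT.le, stepKer_eq_intervalIntegral zero_le_one]
  have h := intervalIntegral.smul_integral_comp_mul_left (a := 0) (b := 1)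
    (fun t => expFun (-x) t) T
  rw [mul_zero, mul_one] at h
  rw [← h, Complex.real_smul]
  congr 2; funext t
  simp only [expFun]
  congr 1; push_cast; ring

/-- The constant 3 is 1 + 2: the kernel is at most 1, and at most 2/|x| by explicit integration. -/
lemma norm_stepKer_one_le (x : ℝ) : ‖stepKer 1 x‖ ≤ 3 * (1 + |x|)⁻¹ := by
  rw [← div_eq_mul_inv, le_div_iff₀ (by positivity)]
  have h1 := norm_stepKer_le zero_le_one x
  rcases eq_or_ne x 0 with rfl | hx
  · rw [abs_zero]; linarith
  have hx' : 0 < |x| := abs_pos.2 hx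
  have h2 : ‖stepKer 1 x‖ * |x| ≤ 2 := by
    have hc : (-(Complex.I * x) : ℂ) ≠ 0 :=
      neg_ne_zero.2 (mul_ne_zero Complex.I_ne_zero (by exact_mod_cast hx))
    have e : stepKer 1 x = (expFun (-x) 1 - expFun (-x) 0) / (-(Complex.I * x)) := by
      rw [stepKer_eq_intervalIntegral zero_le_one]
      have := integral_exp_mul_complex (a := 0) (b := 1) hc
      simp only [expFun] at this ⊢
      push_cast at this ⊢
      simpa only [mul_neg] using this
    rw [e, norm_div, norm_neg, norm_mul, Complex.norm_I, one_mul, Complex.norm_real,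
      Real.norm_eq_abs, div_mul_cancel₀ _ hx'.ne']
    refine (norm_sub_le _ _).trans ?_
    rw [norm_expFun, norm_expFun]; norm_num
  linarith

/-- The product `f (a - x_1) f (x_1 - x_2) ⋯ f (x_n - b)`. -/
def chain {R : Type*} [Mul R] (f : ℝ → R) : (n : ℕ) → ℝ → (Fin n → ℝ) → ℝ → R
  | 0, a, _, b => f (a - b)
  | n + 1, a, x, b => f (a - x 0) * chain f n (x 0) (fun i => x i.succ) b

lemma continuous_chain {R : Type*} [Mul R] [TopologicalSpace R] [ContinuousMul R] {f : ℝ → R}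
    (hf : Continuous f) (n : ℕ) :
    Continuous fun z : ℝ × (Fin n → ℝ) × ℝ => chain f n z.1 z.2.1 z.2.2 := by
  induction n with
  | zero => exact hf.comp (by fun_prop)
  | succ n ih =>
    refine Continuous.mul (hf.comp (by fun_prop)) ?_
    exact ih.comp (g := fun z : ℝ × (Fin n → ℝ) × ℝ => chain f n z.1 z.2.1 z.2.2)
      (f := fun z : ℝ × (Fin (n + 1) → ℝ) × ℝ => (z.2.1 0, fun i : Fin n => z.2.1 i.succ, z.2.2))
      (by fun_prop)

lemma continuous_chain_mid {R : Type*} [Mul R] [TopologicalSpace R] [ContinuousMul R] {f : ℝ → R}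
    (hf : Continuous f) (n : ℕ) (a b : ℝ) : Continuous fun x => chain f n a x b :=
  (continuous_chain hf n).comp (by fun_prop : Continuous fun x : Fin n → ℝ => (a, x, b))

lemma norm_chain_le {f : ℝ → ℂ} {g : ℝ → ℝ} (hfg : ∀ x, ‖f x‖ ≤ g x) (n : ℕ) (a : ℝ)
    (x : Fin n → ℝ) (b : ℝ) : ‖chain f n a x b‖ ≤ chain g n a x b := by
  induction n generalizing a with
  | zero => exact hfg _
  | succ n ih =>
    simp only [chain, norm_mul]
    exact mul_le_mul (hfg _) (ih _ _) (norm_nonneg _) ((norm_nonneg _).trans (hfg _))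

lemma chain_const_mul {R : Type*} [CommMonoid R] (f : ℝ → R) (c : R) (n : ℕ) (a : ℝ)
    (x : Fin n → ℝ) (b : ℝ) :
    chain (fun y => c * f y) n a x b = c ^ (n + 1) * chain f n a x b := by
  induction n generalizing a with
  | zero => simp [chain]
  | succ n ih =>
    simp only [chain, ih]
    rw [pow_succ' c (n + 1), mul_mul_mul_comm]

/-- Only differences of consecutive points enter, so the translation cancels and the reflection
flips the sign of every argument. -/
lemma chain_sub_left {R : Type*} [Mul R] (f : ℝ → R) (c : ℝ) (n : ℕ) (a : ℝ)
    (x : Fin n → ℝ) (b : ℝ) :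
    chain f n (c - a) ((fun _ => c) - x) (c - b) = chain (fun y => f (-y)) n a x b := by
  induction n generalizing a with
  | zero => simp only [chain]; congr 1; ring
  | succ n ih =>
    have := ih (x 0) (fun i => x i.succ)
    simp only [chain, Pi.sub_apply]
    rw [← this]
    congr 2
    ring

lemma chain_comp_mul {R : Type*} [Mul R] (f : ℝ → R) (c : ℝ) (n : ℕ) (a : ℝ)
    (x : Fin n → ℝ) (b : ℝ) :
    chain (fun y => f (c * y)) n a x b = chain f n (c * a) (c • x) (c * b) := by
  induction n generalizing a with
  | zero => simp only [chain, mul_sub]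
  | succ n ih =>
    have := ih (x 0) (fun i => x i.succ)
    simp only [chain, this, Pi.smul_apply, smul_eq_mul, mul_sub]
    rfl

lemma norm_chain_stepKer_le {T : ℝ} (hT : 0 ≤ T) (n : ℕ) (a : ℝ) (x : Fin n → ℝ) (b : ℝ) :
    ‖chain (stepKer T) n a x b‖ ≤ T ^ (n + 1) := by
  refine (norm_chain_le (g := fun _ => T * 1) (fun y => ?_) n a x b).trans (le_of_eq ?_)
  · rw [mul_one]; exact norm_stepKer_le hT y
  · rw [chain_const_mul (fun _ => (1 : ℝ))]
    suffices H : ∀ (m : ℕ) (a : ℝ) (x : Fin m → ℝ), chain (fun _ => (1 : ℝ)) m a x b = 1 by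
      rw [H, mul_one]
    intro m
    induction m with
    | zero => intro a x; rfl
    | succ m ih => intro a x; simp only [chain, ih, mul_one]

/-! ### Integration over `Fin (n + 1) → ℝ` -/

lemma measurePreserving_fin_cons (n : ℕ) :
    MeasurePreserving (fun z : ℝ × (Fin n → ℝ) => (Fin.cons z.1 z.2 : Fin (n + 1) → ℝ)) := by
  have := (volume_preserving_piFinSuccAbove (fun _ : Fin (n + 1) => ℝ) 0).symm
  convert this using 1
  funext z
  simp [MeasurableEquiv.piFinSuccAbove]
  rfl

lemma measurableEmbedding_fin_cons (n : ℕ) :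
    MeasurableEmbedding (fun z : ℝ × (Fin n → ℝ) => (Fin.cons z.1 z.2 : Fin (n + 1) → ℝ)) := by
  have := (MeasurableEquiv.piFinSuccAbove (fun _ : Fin (n + 1) => ℝ) 0).symm.measurableEmbedding
  convert this using 1
  funext z
  simp [MeasurableEquiv.piFinSuccAbove]
  rfl

lemma integral_fin_succ {n : ℕ} (F : (Fin (n + 1) → ℝ) → ℂ) :
    ∫ x, F x = ∫ z : ℝ × (Fin n → ℝ), F (Fin.cons z.1 z.2) :=
  ((measurePreserving_fin_cons n).integral_comp (measurableEmbedding_fin_cons n) F).symm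

lemma lintegral_fin_succ {n : ℕ} {F : (Fin (n + 1) → ℝ) → ℝ≥0∞} (hF : Measurable F) :
    ∫⁻ x, F x = ∫⁻ a, ∫⁻ x : Fin n → ℝ, F (Fin.cons a x) := by
  rw [← (measurePreserving_fin_cons n).lintegral_comp hF, Measure.volume_eq_prod]
  exact lintegral_prod _ (hF.comp (measurePreserving_fin_cons n).measurable).aemeasurable

/-! ### The trace formula -/

lemma integrable_prod_ofReal {n : ℕ} {h : Fin n → ℝ → ℝ} (hh : ∀ i, Integrable (h i)) :
    Integrable fun x : Fin n → ℝ => ∏ i, (h i (x i) : ℂ) :=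
  Integrable.fintype_prod (f := fun i y => (h i y : ℂ)) fun i => (hh i).ofReal

/-- Iterating the spectral representation inserts one frequency per operator, and neighbouring
exponentials pair to `stepKer`. -/
lemma inner_prodOp {T : ℝ} (hT : 0 ≤ T) {n : ℕ} {h : Fin n → ℝ → ℝ} (hh : ∀ i, Integrable (h i))
    (l m : ℝ) :
    inner ℂ (expVec T l) (prodOp h T (expVec T m)) =
      ∫ x : Fin n → ℝ, chain (stepKer T) n l x m * ∏ i, (h i (x i) : ℂ) := by
  induction n generalizing l with
  | zero =>
    rw [prodOp_zero, one_apply_eq_self, inner_expVec_expVec]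
    rw [Measure.volume_pi_eq_dirac (fun i => i.elim0), integral_dirac]
    simp [chain]
  | succ n ih =>
    rw [prodOp_succ, mul_apply_eq_comp, inner_toeplitz (hh 0), integral_fin_succ, Measure.volume_eq_prod,
      integral_prod]
    · congr 1; funext a
      rw [ih (fun i => hh i.succ), inner_expVec_expVec, ← integral_const_mul]
      congr 1; funext x
      simp only [chain, Fin.cons_zero, Fin.cons_succ, Fin.prod_univ_succ]
      ring
    · refine Integrable.bdd_mul (c := T ^ (n + 2)) ?_ ?_
        (ae_of_all _ fun z => norm_chain_stepKer_le hT _ _ _ _)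
      · simp only [Fin.prod_univ_succ, Fin.cons_zero, Fin.cons_succ]
        exact ((hh 0).ofReal (𝕜 := ℂ)).mul_prod (integrable_prod_ofReal fun i => hh i.succ)
      · exact ((continuous_chain_mid (continuous_stepKer T) (n + 1) l m).measurable.comp
          (measurePreserving_fin_cons n).measurable).aestronglyMeasurable

/-- Transports the integrable product of the h_i to the integrand of φ, so that φ is measurable and
Fubini applies to it. -/
lemma measurePreserving_shear (n : ℕ) :
    MeasurePreserving (fun z : ℝ × (Fin n → ℝ) => (z.1, (fun _ => z.1) - z.2)) := by
  refine (MeasurePreserving.id volume).skew_product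
    (g := fun (a : ℝ) (x : Fin n → ℝ) => (fun _ => a) - x) ?_ ?_
  · exact (by fun_prop : Continuous fun z : ℝ × (Fin n → ℝ) => (fun _ : Fin n => z.1) - z.2).measurable
  · exact ae_of_all _ fun a =>
      (Measure.measurePreserving_sub_left (volume : Measure (Fin n → ℝ)) (fun _ => a)).map_eq

lemma integrable_phi_integrand {n : ℕ} {h : Fin (n + 1) → ℝ → ℝ} (hh : ∀ i, Integrable (h i)) :
    Integrable fun z : ℝ × (Fin n → ℝ) => h 0 z.1 * ∏ i : Fin n, h i.succ (z.1 - z.2 i) := by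
  have h1 : Integrable fun z : ℝ × (Fin n → ℝ) => h 0 z.1 * ∏ i : Fin n, h i.succ (z.2 i) :=
    (hh 0).mul_prod (Integrable.fintype_prod (f := fun (i : Fin n) y => h i.succ y)
      fun i => hh i.succ)
  exact (measurePreserving_shear n).integrable_comp_of_integrable h1

lemma aestronglyMeasurable_phi {n : ℕ} {h : Fin (n + 1) → ℝ → ℝ} (hh : ∀ i, Integrable (h i)) :
    AEStronglyMeasurable (phi h) volume :=
  (integrable_phi_integrand hh).1.prod_swap.integral_prod_right'

/-- The Fejér type kernel of the trace for `T = 1`. -/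
def fejerKer (n : ℕ) (x : Fin n → ℝ) : ℂ := chain (fun y => stepKer 1 (-y)) n 0 x 0

lemma continuous_fejerKer (n : ℕ) : Continuous (fejerKer n) :=
  continuous_chain_mid ((continuous_stepKer 1).comp continuous_neg) n 0 0

lemma chain_stepKer_eq_fejerKer {T : ℝ} (hT : 0 < T) {n : ℕ} (l : ℝ) (u : Fin n → ℝ) :
    chain (stepKer T) n l ((fun _ => l) - u) l = (T : ℂ) ^ (n + 1) * fejerKer n (T • u) := by
  have h1 := chain_sub_left (stepKer T) l n 0 u 0
  rw [sub_zero] at h1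
  have h2 : (fun y => stepKer T (-y)) = fun y => (T : ℂ) * stepKer 1 (-(T * y)) := by
    funext y
    rw [stepKer_scale hT]
    congr 2; ring
  rw [h1, h2, chain_const_mul (fun y => stepKer 1 (-(T * y))),
    chain_comp_mul (fun y => stepKer 1 (-y)), mul_zero, fejerKer]

/-- The n + 1 kernels contribute T^{n+1}, the Jacobian of u = x/T gives T^{-n} and the normalization
T^{-1}, so all powers of T cancel. -/
theorem S_eq_integral_fejerKer {n : ℕ} {h : Fin (n + 1) → ℝ → ℝ} (hh : ∀ i, Integrable (h i))
    {T : ℝ} (hT : 0 < T) :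
    S h T = ∫ x, fejerKer n x * (phi h (T⁻¹ • x) : ℂ) := by
  have hTc : (T : ℂ) ≠ 0 := by exact_mod_cast hT.ne'
  set k : (Fin n → ℝ) → ℂ := fun u => (T : ℂ) ^ (n + 1) * fejerKer n (T • u) with hk
  have hkc : Continuous k := continuous_const.mul ((continuous_fejerKer n).comp (by fun_prop))
  have hkb : ∀ u, ‖k u‖ ≤ T ^ (n + 1) := fun u => by
    simp only [hk]
    rw [← chain_stepKer_eq_fejerKer hT 0]
    exact norm_chain_stepKer_le hT.le _ _ _ _
  have e1 : ∀ l, (h 0 l : ℂ) *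
      inner ℂ (expVec T l) (prodOp (fun i => h i.succ) T (expVec T l)) =
      ∫ u, k u * ((h 0 l * ∏ i : Fin n, h i.succ (l - u i) : ℝ) : ℂ) := fun l => by
    rw [inner_prodOp hT.le (fun i => hh i.succ), ← integral_sub_left_eq_self _ volume (fun _ => l),
      ← integral_const_mul]
    congr 1; funext u
    rw [chain_stepKer_eq_fejerKer hT]
    simp only [Pi.sub_apply, hk]
    push_cast; ring
  have e2 : ∫ l, (h 0 l : ℂ) *
      inner ℂ (expVec T l) (prodOp (fun i => h i.succ) T (expVec T l)) =
      ∫ u, k u * (phi h u : ℂ) := by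
    simp only [e1]
    rw [integral_integral_swap]
    · congr 1; funext u
      rw [integral_const_mul, integral_complex_ofReal, phi]
    · exact Integrable.bdd_mul (c := T ^ (n + 1)) (integrable_phi_integrand hh).ofReal
        (hkc.comp continuous_snd).aestronglyMeasurable (ae_of_all _ fun z => hkb z.2)
  have e3 := Measure.integral_comp_smul (volume : Measure (Fin n → ℝ))
    (fun x => fejerKer n x * (phi h (T⁻¹ • x) : ℂ)) T
  simp only [smul_smul, inv_mul_cancel₀ hT.ne', one_smul, Module.finrank_fin_fun] at e3
  have e4 : ∫ u, k u * (phi h u : ℂ) =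
      (T : ℂ) ^ (n + 1) * ∫ u, fejerKer n (T • u) * (phi h u : ℂ) := by
    rw [← integral_const_mul]
    congr 1; funext u
    simp only [hk]; ring
  rw [S_eq (hh 0), e2, e4, e3, abs_of_pos (by positivity), Complex.real_smul]
  push_cast
  field_simp
  ring

lemma M_eq {n : ℕ} (h : Fin (n + 1) → ℝ → ℝ) : M h = (2 * Real.pi) ^ n * phi h 0 := by
  simp only [M, phi, Pi.zero_apply, sub_zero, Fin.prod_univ_succ]

/-! ### Weighted integrability of the kernel -/

lemma one_add_abs_rpow_mul_le {p q : ℝ} (hp : 0 ≤ p) (hq : 0 ≤ q) (s t : ℝ) :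
    (1 + |s|) ^ (-p) * (1 + |t|) ^ (-q) ≤ (1 + |s|) ^ (-(p + q)) + (1 + |t|) ^ (-(p + q)) := by
  have hs : 0 < 1 + |s| := by positivity
  have ht : 0 < 1 + |t| := by positivity
  rcases le_total |s| |t| with h | h
  · have h1 : (1 + |t|) ^ (-q) ≤ (1 + |s|) ^ (-q) :=
      Real.rpow_le_rpow_of_nonpos hs (by linarith) (by linarith)
    calc _ ≤ (1 + |s|) ^ (-p) * (1 + |s|) ^ (-q) := by gcongr
      _ = (1 + |s|) ^ (-(p + q)) := by rw [← Real.rpow_add hs]; congr 1; ring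
      _ ≤ _ := le_add_of_nonneg_right (by positivity)
  · have h1 : (1 + |s|) ^ (-p) ≤ (1 + |t|) ^ (-p) :=
      Real.rpow_le_rpow_of_nonpos ht (by linarith) (by linarith)
    calc _ ≤ (1 + |t|) ^ (-p) * (1 + |t|) ^ (-q) := by gcongr
      _ = (1 + |t|) ^ (-(p + q)) := by rw [← Real.rpow_add ht]; congr 1; ring
      _ ≤ _ := le_add_of_nonneg_left (by positivity)

/-- Multiply by (1+|y|)^c and split it by subadditivity into (1+|y-x|)^c + (1+|x|)^c. Each half
lowers one exponent by c, leaving products of total exponent 1 + a - c, which are bounded by a sum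
of single powers. -/
lemma one_add_abs_mul_le {a c : ℝ} (hc : 0 ≤ c) (hca : c ≤ a) (ha : a ≤ 1) (y x : ℝ) :
    (1 + |y - x|)⁻¹ * (1 + |x|) ^ (-a) ≤ (1 + |y|) ^ (-c) *
      (2 * ((1 + |y - x|) ^ (-(1 + a - c)) + (1 + |x|) ^ (-(1 + a - c)))) := by
  have hy : 0 < 1 + |y| := by positivity
  have hx : 0 < 1 + |x| := by positivity
  have hyx : 0 < 1 + |y - x| := by positivity
  have h1 : (1 + |y|) ^ c ≤ (1 + |y - x|) ^ c + (1 + |x|) ^ c := by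
    refine le_trans ?_ (Real.rpow_add_le_add_rpow hyx.le hx.le hc (hca.trans ha))
    refine Real.rpow_le_rpow hy.le ?_ hc
    have := abs_add_le (y - x) x
    rw [sub_add_cancel] at this
    linarith
  have h2 := one_add_abs_rpow_mul_le (p := 1 - c) (q := a) (by linarith) (by linarith) (y - x) x
  have h3 := one_add_abs_rpow_mul_le (p := 1) (q := a - c) (by linarith) (by linarith) (y - x) x
  have e2 : -(1 - c + a) = -(1 + a - c) := by ring
  have e3 : -(1 + (a - c)) = -(1 + a - c) := by ring
  rw [e2] at h2
  rw [e3] at h3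
  rw [← Real.rpow_neg_one]
  have e : (1 + |y - x|) ^ (-1 : ℝ) * (1 + |x|) ^ (-a) = (1 + |y|) ^ (-c) * ((1 + |y|) ^ c *
      ((1 + |y - x|) ^ (-1 : ℝ) * (1 + |x|) ^ (-a))) := by
    rw [← mul_assoc, ← Real.rpow_add hy, neg_add_cancel, Real.rpow_zero, one_mul]
  rw [e]
  refine mul_le_mul_of_nonneg_left ?_ (by positivity)
  calc _ ≤ ((1 + |y - x|) ^ c + (1 + |x|) ^ c) *
      ((1 + |y - x|) ^ (-1 : ℝ) * (1 + |x|) ^ (-a)) := by gcongr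
    _ = (1 + |y - x|) ^ (-(1 - c)) * (1 + |x|) ^ (-a) +
        (1 + |y - x|) ^ (-1 : ℝ) * (1 + |x|) ^ (-(a - c)) := by
      rw [show -(1 - c) = c + -1 by ring, show -(a - c) = c + -a by ring, Real.rpow_add hyx,
        Real.rpow_add hx]
      ring
    _ ≤ _ := by linarith

/-- Convolving with 1/(1+|x|) costs an arbitrarily small part of the decay: c < a makes the
remaining exponent 1 + a - c exceed 1. -/
lemma lintegral_conv_le {a c : ℝ} (hc : 0 ≤ c) (hca : c < a) (ha : a ≤ 1) :
    ∃ C : ℝ, 0 ≤ C ∧ ∀ y : ℝ, ∫⁻ x, ENNReal.ofReal ((1 + |y - x|)⁻¹ * (1 + |x|) ^ (-a)) ≤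
      ENNReal.ofReal (C * (1 + |y|) ^ (-c)) := by
  have hi : Integrable fun x : ℝ => (1 + |x|) ^ (-(1 + a - c)) :=
    integrable_one_add_norm (E := ℝ) (by simp; linarith)
  set I : ℝ := ∫ x : ℝ, (1 + |x|) ^ (-(1 + a - c)) with hI
  have hI0 : 0 ≤ I := integral_nonneg fun x => by positivity
  refine ⟨4 * I, by positivity, fun y => ?_⟩
  have hi' : Integrable fun x : ℝ => (1 + |y|) ^ (-c) *
      (2 * ((1 + |y - x|) ^ (-(1 + a - c)) + (1 + |x|) ^ (-(1 + a - c)))) :=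
    (((hi.comp_sub_left y).add hi).const_mul 2).const_mul _
  calc _ ≤ ∫⁻ x, ENNReal.ofReal ((1 + |y|) ^ (-c) *
      (2 * ((1 + |y - x|) ^ (-(1 + a - c)) + (1 + |x|) ^ (-(1 + a - c))))) :=
        lintegral_mono fun x => ENNReal.ofReal_le_ofReal (one_add_abs_mul_le hc hca.le ha y x)
    _ = ENNReal.ofReal (4 * I * (1 + |y|) ^ (-c)) := by
        rw [← ofReal_integral_eq_lintegral_ofReal hi' (ae_of_all _ fun x => by positivity),
          integral_const_mul, integral_const_mul, integral_add (hi.comp_sub_left y) hi,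
          integral_sub_left_eq_self (fun x => (1 + |x|) ^ (-(1 + a - c))) volume y, ← hI]
        congr 1; ring

lemma continuous_inv_one_add_abs : Continuous fun y : ℝ => (1 + |y|)⁻¹ :=
  Continuous.inv₀ (by fun_prop) fun y => by positivity

lemma chain_inv_nonneg (n : ℕ) (a : ℝ) (x : Fin n → ℝ) (b : ℝ) :
    0 ≤ chain (fun y : ℝ => (1 + |y|)⁻¹) n a x b := by
  induction n generalizing a with
  | zero => simp only [chain]; positivity
  | succ n ih => exact mul_nonneg (by positivity) (ih _ _)

lemma measurable_chain_weight (n : ℕ) (γ a s : ℝ) : Measurable fun x : Fin n → ℝ =>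
    ENNReal.ofReal (chain (fun y : ℝ => (1 + |y|)⁻¹) n a x 0 * (s + ∑ i, |x i|) ^ γ) := by
  refine ((continuous_chain_mid continuous_inv_one_add_abs n a 0).measurable.mul ?_).ennreal_ofReal
  exact Measurable.pow_const (by fun_prop) _

/-- Induction on the number of variables with a free starting point a. Decay in a is included
because the next convolution needs it; each step spends some exponent, for which γ + c < 1 leaves
room. -/
lemma lintegral_chain_weight_le (n : ℕ) {γ c : ℝ} (hγ : 0 ≤ γ) (hc : 0 ≤ c) (hγc : γ + c < 1) :
    ∃ C : ℝ, 0 ≤ C ∧ ∀ a : ℝ, ∫⁻ x : Fin n → ℝ, ENNReal.ofReal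
      (chain (fun y : ℝ => (1 + |y|)⁻¹) n a x 0 * (1 + |a| + ∑ i, |x i|) ^ γ) ≤
        ENNReal.ofReal (C * (1 + |a|) ^ (-c)) := by
  induction n generalizing γ c with
  | zero =>
    refine ⟨1, zero_le_one, fun a => ?_⟩
    rw [Measure.volume_pi_eq_dirac (fun i => i.elim0), lintegral_dirac]
    refine ENNReal.ofReal_le_ofReal ?_
    have ha : 0 < 1 + |a| := by positivity
    simp only [chain, sub_zero, Finset.univ_eq_empty, Finset.sum_empty, add_zero, one_mul]
    rw [← Real.rpow_neg_one, ← Real.rpow_add ha]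
    exact Real.rpow_le_rpow_of_exponent_le (by linarith [abs_nonneg a]) (by linarith)
  | succ n ih =>
    -- The weight splits as (1+|a|)^γ plus the weight of the shorter chain. The first part needs
    -- decay γ + c after convolution, so it starts from the midpoint of γ + c and 1; the second
    -- needs decay c, so it starts from the midpoint of c and 1 - γ.
    obtain ⟨C₁, hC₁, h₁⟩ := ih (γ := 0) (c := (γ + c + 1) / 2) le_rfl (by linarith) (by linarith)
    obtain ⟨C₂, hC₂, h₂⟩ := ih (γ := γ) (c := (c + 1 - γ) / 2) hγ (by linarith) (by linarith)
    obtain ⟨K₁, hK₁, g₁⟩ := lintegral_conv_le (a := (γ + c + 1) / 2) (c := γ + c) (by linarith)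
      (by linarith) (by linarith)
    obtain ⟨K₂, hK₂, g₂⟩ := lintegral_conv_le (a := (c + 1 - γ) / 2) (c := c) (by linarith)
      (by linarith) (by linarith)
    refine ⟨C₁ * K₁ + C₂ * K₂, by positivity, fun a => ?_⟩
    have ha : 0 < 1 + |a| := by positivity
    rw [lintegral_fin_succ (measurable_chain_weight _ _ _ _)]
    have key : ∀ y : ℝ, ∫⁻ x : Fin n → ℝ, ENNReal.ofReal
        (chain (fun y : ℝ => (1 + |y|)⁻¹) (n + 1) a (Fin.cons y x) 0 *
          (1 + |a| + ∑ i, |(Fin.cons y x : Fin (n + 1) → ℝ) i|) ^ γ) ≤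
        ENNReal.ofReal ((1 + |a|) ^ γ * C₁) *
          ENNReal.ofReal ((1 + |a - y|)⁻¹ * (1 + |y|) ^ (-((γ + c + 1) / 2))) +
        ENNReal.ofReal C₂ *
          ENNReal.ofReal ((1 + |a - y|)⁻¹ * (1 + |y|) ^ (-((c + 1 - γ) / 2))) := by
      intro y
      have hp : ∀ x : Fin n → ℝ, ENNReal.ofReal
          (chain (fun y : ℝ => (1 + |y|)⁻¹) (n + 1) a (Fin.cons y x) 0 *
          (1 + |a| + ∑ i, |(Fin.cons y x : Fin (n + 1) → ℝ) i|) ^ γ) ≤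
          ENNReal.ofReal ((1 + |a|) ^ γ * (1 + |a - y|)⁻¹) * ENNReal.ofReal
            (chain (fun y : ℝ => (1 + |y|)⁻¹) n y x 0 * (1 + |y| + ∑ i, |x i|) ^ (0 : ℝ)) +
          ENNReal.ofReal ((1 + |a - y|)⁻¹) * ENNReal.ofReal
            (chain (fun y : ℝ => (1 + |y|)⁻¹) n y x 0 * (1 + |y| + ∑ i, |x i|) ^ γ) := by
        intro x
        have hn := chain_inv_nonneg n y x 0
        have hs : 0 ≤ ∑ i, |x i| := Finset.sum_nonneg fun i _ => abs_nonneg _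
        rw [← ENNReal.ofReal_mul (by positivity), ← ENNReal.ofReal_mul (by positivity),
          ← ENNReal.ofReal_add (by positivity) (by positivity)]
        refine ENNReal.ofReal_le_ofReal ?_
        simp only [chain, Fin.cons_zero, Fin.cons_succ, Fin.sum_univ_succ, Real.rpow_zero, mul_one]
        have h3 : (1 + |a| + (|y| + ∑ i, |x i|)) ^ γ ≤
            (1 + |a|) ^ γ + (1 + |y| + ∑ i, |x i|) ^ γ := by
          refine le_trans ?_ (Real.rpow_add_le_add_rpow ha.le (by positivity) hγ (by linarith))
          exact Real.rpow_le_rpow (by positivity) (by linarith) hγ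
        calc _ ≤ (1 + |a - y|)⁻¹ * chain (fun y : ℝ => (1 + |y|)⁻¹) n y x 0 *
            ((1 + |a|) ^ γ + (1 + |y| + ∑ i, |x i|) ^ γ) := by gcongr
          _ = _ := by ring
      refine (lintegral_mono hp).trans ?_
      rw [lintegral_add_left ((measurable_chain_weight n 0 y _).const_mul _),
        lintegral_const_mul _ (measurable_chain_weight n 0 y _),
        lintegral_const_mul _ (measurable_chain_weight n γ y _)]
      refine (add_le_add (mul_le_mul_right (h₁ y) _) (mul_le_mul_right (h₂ y) _)).trans
        (le_of_eq ?_)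
      rw [← ENNReal.ofReal_mul (by positivity), ← ENNReal.ofReal_mul (by positivity),
        ← ENNReal.ofReal_mul (by positivity), ← ENNReal.ofReal_mul (by positivity)]
      congr 2 <;> ring
    have hm : ∀ d : ℝ, Measurable fun y : ℝ =>
        ENNReal.ofReal ((1 + |a - y|)⁻¹ * (1 + |y|) ^ (-d)) := fun d =>
      ((continuous_inv_one_add_abs.comp (continuous_const.sub continuous_id)).measurable.mul
        (Measurable.pow_const (by fun_prop) _)).ennreal_ofReal
    refine (lintegral_mono key).trans ?_
    rw [lintegral_add_left ((hm _).const_mul _), lintegral_const_mul _ (hm _),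
      lintegral_const_mul _ (hm _)]
    refine (add_le_add (mul_le_mul_right (g₁ a) _) (mul_le_mul_right (g₂ a) _)).trans
      (le_of_eq ?_)
    rw [← ENNReal.ofReal_mul (by positivity), ← ENNReal.ofReal_mul (by positivity),
      ← ENNReal.ofReal_add (by positivity) (by positivity)]
    congr 1
    have : (1 + |a|) ^ γ * (1 + |a|) ^ (-(γ + c)) = (1 + |a|) ^ (-c) := by
      rw [← Real.rpow_add ha]; congr 1; ring
    linear_combination (C₁ * K₁) * this

lemma integrable_fejerKer_weight (n : ℕ) {γ : ℝ} (hγ : 0 ≤ γ) (hγ1 : γ < 1) :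
    Integrable fun x : Fin n → ℝ => ‖fejerKer n x‖ * (1 + ∑ i, |x i|) ^ γ := by
  obtain ⟨C, hC, h⟩ := lintegral_chain_weight_le n (c := 0) hγ le_rfl (by linarith)
  have h0 := h 0
  simp only [abs_zero, add_zero] at h0
  have hb : ∀ x, ‖fejerKer n x‖ ≤ 3 ^ (n + 1) * chain (fun y : ℝ => (1 + |y|)⁻¹) n 0 x 0 := by
    intro x
    rw [← chain_const_mul (fun y : ℝ => (1 + |y|)⁻¹), fejerKer]
    refine norm_chain_le (fun y => ?_) n 0 x 0
    simpa using norm_stepKer_one_le (-y)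
  have hm : Measurable fun x : Fin n → ℝ => (1 + ∑ i, |x i|) ^ γ :=
    Measurable.pow_const (by fun_prop) _
  have hi : Integrable fun x : Fin n → ℝ => 3 ^ (n + 1) *
      (chain (fun y : ℝ => (1 + |y|)⁻¹) n 0 x 0 * (1 + ∑ i, |x i|) ^ γ) := by
    refine Integrable.const_mul ⟨?_, ?_⟩ _
    · exact ((continuous_chain_mid continuous_inv_one_add_abs n 0 0).measurable.mul
        hm).aestronglyMeasurable
    · rw [hasFiniteIntegral_iff_ofReal (ae_of_all _ fun x => ?_)]
      · exact h0.trans_lt ENNReal.ofReal_lt_top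
      · exact mul_nonneg (chain_inv_nonneg _ _ _ _) (by positivity)
  refine hi.mono' ?_ (ae_of_all _ fun x => ?_)
  · exact ((continuous_fejerKer n).norm.measurable.mul hm).aestronglyMeasurable
  · rw [Real.norm_of_nonneg (by positivity), ← mul_assoc]
    exact mul_le_mul_of_nonneg_right (hb x) (by positivity)

lemma integrable_fejerKer (n : ℕ) : Integrable (fejerKer n) := by
  refine (integrable_fejerKer_weight n le_rfl zero_lt_one).mono'
    (continuous_fejerKer n).aestronglyMeasurable (ae_of_all _ fun x => ?_)
  rw [Real.rpow_zero, mul_one]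

/-! ### Approximation of the trace by a multiple of `φ(0)` -/

/-- The condition on φ holds only almost everywhere and must survive the rescaling x ↦ x/T. -/
lemma quasiMeasurePreserving_smul_pi (n : ℕ) {r : ℝ} (hr : r ≠ 0) :
    Measure.QuasiMeasurePreserving (fun x : Fin n → ℝ => r • x) := by
  refine ⟨by fun_prop, Measure.AbsolutelyContinuous.mk fun s hs h0 => ?_⟩
  rw [Measure.map_apply (by fun_prop) hs]
  have := Measure.addHaar_preimage_smul (volume : Measure (Fin n → ℝ)) hr s
  rw [h0, mul_zero] at this
  exact this

lemma S_sub_isBigO {n : ℕ} {h : Fin (n + 1) → ℝ → ℝ} (hh : ∀ i, Integrable (h i)) {C γ : ℝ}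
    (hγ : 0 < γ) (hγ1 : γ < 1)
    (hphi : ∀ᵐ u : Fin n → ℝ, |phi h u - phi h 0| ≤ C * (∑ i, |u i|) ^ γ) :
    (fun T : ℝ => S h T - (∫ x, fejerKer n x) * (phi h 0 : ℂ)) =O[atTop]
      fun T : ℝ => T ^ (-γ) := by
  set D : ℝ := ∫ x : Fin n → ℝ, ‖fejerKer n x‖ * (1 + ∑ i, |x i|) ^ γ with hD
  refine IsBigO.of_bound (|C| * D) ?_
  filter_upwards [eventually_gt_atTop 0] with T hT
  have hq := quasiMeasurePreserving_smul_pi n (inv_ne_zero hT.ne')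
  have hae : ∀ᵐ x : Fin n → ℝ,
      ‖fejerKer n x * ((phi h (T⁻¹ • x) : ℂ) - (phi h 0 : ℂ))‖ ≤
        |C| * T ^ (-γ) * (‖fejerKer n x‖ * (1 + ∑ i, |x i|) ^ γ) := by
    filter_upwards [hq.ae hphi] with x hx
    have hs : 0 ≤ ∑ i, |x i| := Finset.sum_nonneg fun i _ => abs_nonneg _
    have e : ∑ i, |(T⁻¹ • x) i| = T⁻¹ * ∑ i, |x i| := by
      simp only [Pi.smul_apply, smul_eq_mul, abs_mul, abs_inv, abs_of_pos hT, Finset.mul_sum]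
    have h1 : |phi h (T⁻¹ • x) - phi h 0| ≤ |C| * (T ^ (-γ) * (1 + ∑ i, |x i|) ^ γ) := by
      refine hx.trans ?_
      rw [e, Real.mul_rpow (by positivity) hs, Real.inv_rpow hT.le, ← Real.rpow_neg hT.le]
      refine mul_le_mul (le_abs_self C) ?_ (by positivity) (abs_nonneg C)
      gcongr
      linarith
    rw [norm_mul, ← Complex.ofReal_sub, Complex.norm_real, Real.norm_eq_abs]
    calc _ ≤ ‖fejerKer n x‖ * (|C| * (T ^ (-γ) * (1 + ∑ i, |x i|) ^ γ)) := by gcongr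
      _ = _ := by ring
  have hi := (integrable_fejerKer_weight n hγ.le hγ1).const_mul (|C| * T ^ (-γ))
  have hi1 : Integrable fun x => fejerKer n x * ((phi h (T⁻¹ • x) : ℂ) - (phi h 0 : ℂ)) := by
    refine hi.mono' ((continuous_fejerKer n).aestronglyMeasurable.mul
      (AEStronglyMeasurable.sub ?_ aestronglyMeasurable_const)) hae
    exact Complex.continuous_ofReal.comp_aestronglyMeasurable
      ((aestronglyMeasurable_phi hh).comp_quasiMeasurePreserving hq)
  have e : S h T - (∫ x, fejerKer n x) * (phi h 0 : ℂ) =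
      ∫ x, fejerKer n x * ((phi h (T⁻¹ • x) : ℂ) - (phi h 0 : ℂ)) := by
    rw [S_eq_integral_fejerKer hh hT, sub_eq_iff_eq_add, ← integral_mul_const,
      ← integral_add hi1 ((integrable_fejerKer n).mul_const _)]
    congr 1; funext x; ring
  rw [e]
  refine (norm_integral_le_of_norm_le hi hae).trans (le_of_eq ?_)
  rw [integral_const_mul, ← hD, Real.norm_of_nonneg (by positivity)]
  ring

/-! ### Hölder's inequality and `L^p` interpolation -/

section Lp

variable {α : Type*} [MeasurableSpace α] {μ : Measure α}

/-- Hölder's inequality by induction on the factors. The empty product is the constant 1, measured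
in L^∞. -/
lemma eLpNorm_finset_prod_le {ι : Type*} [DecidableEq ι] (s : Finset ι) {f : ι → α → ℝ}
    {p : ι → ℝ≥0∞} (hf : ∀ i ∈ s, AEStronglyMeasurable (f i) μ) :
    eLpNorm (fun x => ∏ i ∈ s, f i x) (∑ i ∈ s, (p i)⁻¹)⁻¹ μ ≤ ∏ i ∈ s, eLpNorm (f i) (p i) μ := by
  induction s using Finset.induction_on with
  | empty =>
    simp only [Finset.prod_empty, Finset.sum_empty, ENNReal.inv_zero]
    refine (eLpNorm_le_of_ae_bound (C := 1) (ae_of_all _ fun _ => by simp)).trans ?_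
    simp
  | insert a s ha ih =>
    have : ENNReal.HolderTriple (p a) (∑ i ∈ s, (p i)⁻¹)⁻¹ (∑ i ∈ insert a s, (p i)⁻¹)⁻¹ :=
      ⟨by simp [Finset.sum_insert ha]⟩
    have h1 := eLpNorm_smul_le_mul_eLpNorm (μ := μ) (p := p a) (q := (∑ i ∈ s, (p i)⁻¹)⁻¹)
      (r := (∑ i ∈ insert a s, (p i)⁻¹)⁻¹)
      (Finset.aestronglyMeasurable_fun_prod s fun i hi => hf i (Finset.mem_insert_of_mem hi))
      (hf a (Finset.mem_insert_self a s))
    rw [Finset.prod_insert ha]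
    refine le_trans (le_of_eq ?_) (h1.trans (mul_le_mul' le_rfl
      (ih fun i hi => hf i (Finset.mem_insert_of_mem hi))))
    congr 1
    funext x
    simp [Finset.prod_insert ha]

/-- Split where |f| reaches 1: the large part lives on a set of finite measure, by Markov, so its
L^p bound suffices; on the small part |f|^q ≤ |f|. -/
lemma _root_.MeasureTheory.MemLp.of_integrable_of_le {f : α → ℝ} {p q : ℝ≥0∞}
    (hf1 : Integrable f μ) (hfp : MemLp f p μ) (hq : 1 ≤ q) (hqp : q ≤ p) : MemLp f q μ := by
  rcases eq_or_ne q ∞ with rfl | hqt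
  · rwa [top_le_iff.1 hqp] at hfp
  have hq0 : q ≠ 0 := (zero_lt_one.trans_le hq).ne'
  have hqr : 1 ≤ q.toReal := by
    rw [← ENNReal.toReal_one]; exact ENNReal.toReal_mono hqt hq
  have hfg := hf1.1.ae_eq_mk
  set g := hf1.1.mk f with hg
  have hgm : StronglyMeasurable g := hf1.1.stronglyMeasurable_mk
  have hg1 : Integrable g μ := hf1.congr hfg
  have hgp : MemLp g p μ := hfp.ae_eq hfg
  refine MemLp.ae_eq hfg.symm ?_
  set s : Set α := {x | 1 ≤ ‖g x‖} with hs
  have hsm : MeasurableSet s := measurableSet_le measurable_const hgm.norm.measurable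
  rw [← Set.indicator_self_add_compl s g]
  refine MemLp.add ?_ ?_
  · refine (hgp.indicator hsm).mono_exponent_of_measure_support_ne_top (s := s)
      (fun x hx => Set.indicator_of_notMem hx _) ?_ hqp
    exact (hg1.measure_norm_ge_lt_top zero_lt_one).ne
  · have hm : AEStronglyMeasurable (sᶜ.indicator g) μ :=
      (hgm.indicator hsm.compl).aestronglyMeasurable
    rw [← integrable_norm_rpow_iff hm hq0 hqt]
    refine hg1.norm.mono' (hm.norm.aemeasurable.pow_const _).aestronglyMeasurable
      (ae_of_all _ fun x => ?_)
    by_cases hx : x ∈ s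
    · rw [Set.indicator_of_notMem (by simpa using! hx), norm_zero,
        Real.zero_rpow (by linarith), norm_zero]
      exact norm_nonneg _
    · rw [Set.indicator_of_mem (by simpa using! hx), Real.norm_of_nonneg (by positivity)]
      have h1 : ‖g x‖ ≤ 1 := (not_le.1 hx).le
      exact (Real.rpow_le_rpow_of_exponent_ge' (norm_nonneg _) h1 zero_le_one hqr).trans
        (by rw [Real.rpow_one])

end Lp

/-- Telescoping: each summand has one difference factor, and the other factors are bounded crudely
and symmetrically. -/
lemma abs_prod_sub_prod_le {ι : Type*} [DecidableEq ι] (s : Finset ι) (a b : ι → ℝ) :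
    |∏ i ∈ s, a i - ∏ i ∈ s, b i| ≤
      ∑ j ∈ s, ∏ i ∈ s, if i = j then |a i - b i| else |a i| + |b i| := by
  induction s using Finset.induction_on with
  | empty => simp
  | insert k s hk ih =>
    rw [Finset.prod_insert hk, Finset.prod_insert hk, Finset.sum_insert hk, Finset.prod_insert hk,
      if_pos rfl]
    have e1 : ∏ i ∈ s, (if i = k then |a i - b i| else |a i| + |b i|) =
        ∏ i ∈ s, (|a i| + |b i|) :=
      Finset.prod_congr rfl fun i hi => if_neg fun e : i = k => hk (e ▸ hi)
    have e2 : ∑ j ∈ s, ∏ i ∈ insert k s, (if i = j then |a i - b i| else |a i| + |b i|) =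
        (|a k| + |b k|) * ∑ j ∈ s, ∏ i ∈ s, if i = j then |a i - b i| else |a i| + |b i| := by
      rw [Finset.mul_sum]
      refine Finset.sum_congr rfl fun j hj => ?_
      rw [Finset.prod_insert hk, if_neg fun e : k = j => hk (e ▸ hj)]
    rw [e1, e2]
    have e3 : a k * ∏ i ∈ s, a i - b k * ∏ i ∈ s, b i =
        (a k - b k) * ∏ i ∈ s, a i + b k * (∏ i ∈ s, a i - ∏ i ∈ s, b i) := by ring
    rw [e3]
    refine (abs_add_le _ _).trans (add_le_add ?_ ?_)
    · rw [abs_mul, Finset.abs_prod]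
      refine mul_le_mul_of_nonneg_left ?_ (abs_nonneg _)
      exact Finset.prod_le_prod (fun i _ => abs_nonneg _) fun i _ =>
        le_add_of_nonneg_right (abs_nonneg _)
    · rw [abs_mul]
      refine mul_le_mul (le_add_of_nonneg_left (abs_nonneg _)) ih (abs_nonneg _) (by positivity)

lemma eLpNorm_comp_sub_right {p : ℝ≥0∞} {f : ℝ → ℝ} (hf : AEStronglyMeasurable f volume) (t : ℝ) :
    eLpNorm (fun x => f (x - t)) p volume = eLpNorm f p volume :=
  eLpNorm_comp_measurePreserving hf (measurePreserving_sub_right volume t)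

lemma aestronglyMeasurable_comp_sub_right {f : ℝ → ℝ} (hf : AEStronglyMeasurable f volume)
    (t : ℝ) : AEStronglyMeasurable (fun x => f (x - t)) volume :=
  hf.comp_measurePreserving (measurePreserving_sub_right volume t)

lemma eLpNorm_abs_add_abs_le {p : ℝ≥0∞} (hp : 1 ≤ p) {f : ℝ → ℝ}
    (hf : AEStronglyMeasurable f volume) (t : ℝ) :
    eLpNorm (fun x => |f (x - t)| + |f x|) p volume ≤ 2 * eLpNorm f p volume := by
  have hf' := aestronglyMeasurable_comp_sub_right hf t
  refine (eLpNorm_add_le (f := fun x => |f (x - t)|) (g := fun x => |f x|)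
    hf'.norm hf.norm hp).trans (le_of_eq ?_)
  have h1 := eLpNorm_norm (μ := volume) (p := p) (fun x => f (x - t))
  have h2 := eLpNorm_norm (μ := volume) (p := p) f
  simp only [Real.norm_eq_abs] at h1 h2
  rw [h1, h2, eLpNorm_comp_sub_right hf, two_mul]

/-! ### Regularity of `φ` -/

section Phi

variable {n : ℕ} {h : Fin (n + 1) → ℝ → ℝ} {q : Fin (n + 1) → ℝ≥0∞}

lemma phi_eq (h : Fin (n + 1) → ℝ → ℝ) (u : Fin n → ℝ) :
    phi h u = ∫ l, ∏ i, h i (l - (Fin.cons 0 u : Fin (n + 1) → ℝ) i) := by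
  simp only [phi, Fin.prod_univ_succ, Fin.cons_zero, Fin.cons_succ, sub_zero]

lemma integrable_prod_sub (hq : ∑ i, (q i)⁻¹ = 1) (hh : ∀ i, MemLp (h i) (q i) volume)
    (v : Fin (n + 1) → ℝ) : Integrable fun l => ∏ i, h i (l - v i) := by
  have h1 : MemLp (fun l => ∏ i, h i (l - v i)) (∑ i, (q i)⁻¹)⁻¹ volume :=
    MemLp.prod' (f := fun i l => h i (l - v i)) fun i _ =>
      (hh i).comp_measurePreserving (measurePreserving_sub_right volume (v i))
  rwa [hq, inv_one, memLp_one_iff_integrable] at h1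

lemma integrable_prod_of_memLp (hq : ∑ i, (q i)⁻¹ = 1) (hh : ∀ i, MemLp (h i) (q i) volume) :
    Integrable fun l => ∏ i, h i l := by
  simpa using integrable_prod_sub hq hh 0

lemma exists_abs_phi_le (hq : ∑ i, (q i)⁻¹ = 1) (hh : ∀ i, MemLp (h i) (q i) volume) :
    ∃ B : ℝ, ∀ u, |phi h u| ≤ B := by
  have hfin : ∏ i, eLpNorm (h i) (q i) volume ≠ ∞ :=
    ENNReal.prod_ne_top fun i _ => (hh i).2.ne
  refine ⟨(∏ i, eLpNorm (h i) (q i) volume).toReal, fun u => ?_⟩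
  rw [phi_eq, ← Real.norm_eq_abs, ← toReal_enorm]
  refine ENNReal.toReal_mono hfin ((enorm_integral_le_lintegral_enorm _).trans ?_)
  have h1 := eLpNorm_finset_prod_le (μ := volume) Finset.univ (p := q)
    (f := fun i l => h i (l - (Fin.cons 0 u : Fin (n + 1) → ℝ) i))
    fun i _ => aestronglyMeasurable_comp_sub_right (hh i).1 _
  rw [hq, inv_one, eLpNorm_one_eq_lintegral_enorm] at h1
  refine h1.trans (le_of_eq (Finset.prod_congr rfl fun i _ => ?_))
  exact eLpNorm_comp_sub_right (hh i).1 _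

/-- Telescoping followed by Hölder's inequality. The factor h 0 is never shifted, so no smoothness
of it enters. -/
lemma exists_abs_phi_sub_le (hq1 : ∀ i, 1 ≤ q i) (hq : ∑ i, (q i)⁻¹ = 1)
    (hh : ∀ i, MemLp (h i) (q i) volume) {C γ : ℝ} (hC : 0 ≤ C) (hγ : 0 < γ)
    (hL : ∀ (i : Fin n) (t : ℝ), eLpNorm (fun x => h i.succ (x - t) - h i.succ x) (q i.succ) volume
      ≤ ENNReal.ofReal (C * |t| ^ γ)) :
    ∃ D : ℝ, 0 ≤ D ∧ ∀ u : Fin n → ℝ, |phi h u - phi h 0| ≤ D * (∑ i, |u i|) ^ γ := by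
  -- The added 1 lets the same P bound every telescoping term, also in the slot that holds the
  -- difference.
  set P : ℝ≥0∞ := ∏ i, (1 + 2 * eLpNorm (h i) (q i) volume) with hP
  have hPfin : P ≠ ∞ := ENNReal.prod_ne_top fun i _ =>
    ENNReal.add_ne_top.2 ⟨by simp, ENNReal.mul_ne_top (by simp) (hh i).2.ne⟩
  refine ⟨(n + 1) * P.toReal * C, by positivity, fun u => ?_⟩
  set s : ℝ := ∑ i, |u i| with hs
  have hs0 : 0 ≤ s := Finset.sum_nonneg fun i _ => abs_nonneg _
  set v : Fin (n + 1) → ℝ := Fin.cons 0 u with hv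
  have hD : ∀ j, eLpNorm (fun x => |h j (x - v j) - h j x|) (q j) volume ≤
      ENNReal.ofReal (C * s ^ γ) := by
    intro j
    have h1 := eLpNorm_norm (μ := volume) (p := q j) (fun x => h j (x - v j) - h j x)
    simp only [Real.norm_eq_abs] at h1
    rw [h1]
    refine Fin.cases ?_ (fun i => ?_) j
    · simp [hv]
    · simp only [hv, Fin.cons_succ]
      refine (hL i (u i)).trans (ENNReal.ofReal_le_ofReal ?_)
      gcongr
      exact Finset.single_le_sum (f := fun i => |u i|) (fun i _ => abs_nonneg _)
        (Finset.mem_univ i)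
  set F : Fin (n + 1) → Fin (n + 1) → ℝ → ℝ := fun j i x =>
    if i = j then |h i (x - v i) - h i x| else |h i (x - v i)| + |h i x| with hF
  have hm : ∀ i, AEStronglyMeasurable (fun x => h i (x - v i)) volume := fun i =>
    aestronglyMeasurable_comp_sub_right (hh i).1 _
  have hFm : ∀ j i, AEStronglyMeasurable (F j i) volume := by
    intro j i
    by_cases hij : i = j
    · simp only [hF, if_pos hij]
      exact ((hm i).sub (hh i).1).norm
    · simp only [hF, if_neg hij]
      exact (hm i).norm.add (hh i).1.norm
  have hFb : ∀ j i, eLpNorm (F j i) (q i) volume ≤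
      (if i = j then ENNReal.ofReal (C * s ^ γ) else 1) *
        (1 + 2 * eLpNorm (h i) (q i) volume) := by
    intro j i
    by_cases hij : i = j
    · simp only [hF, if_pos hij]
      exact (hD i).trans (le_mul_of_one_le_right' le_self_add)
    · simp only [hF, if_neg hij, one_mul]
      exact (eLpNorm_abs_add_abs_le (hq1 i) (hh i).1 (v i)).trans le_add_self
  have hone : ∀ j, ∫⁻ x, ‖∏ i, F j i x‖ₑ ≤ ENNReal.ofReal (C * s ^ γ) * P := by
    intro j
    have h1 := eLpNorm_finset_prod_le (μ := volume) Finset.univ (p := q) (f := F j)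
      fun i _ => hFm j i
    rw [hq, inv_one, eLpNorm_one_eq_lintegral_enorm] at h1
    refine h1.trans ((Finset.prod_le_prod' fun i _ => hFb j i).trans (le_of_eq ?_))
    rw [Finset.prod_mul_distrib, Finset.prod_ite_eq' Finset.univ j, if_pos (Finset.mem_univ j)]
  have e0 : phi h 0 = ∫ l, ∏ i, h i (l - (0 : Fin (n + 1) → ℝ) i) := by
    simp only [phi, Fin.prod_univ_succ, Pi.zero_apply, sub_zero]
  have hmain : ‖phi h u - phi h 0‖ₑ ≤ (n + 1 : ℕ) * (ENNReal.ofReal (C * s ^ γ) * P) := by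
    rw [phi_eq, ← hv, e0, ← integral_sub (integrable_prod_sub hq hh v) (integrable_prod_sub hq hh 0)]
    refine (enorm_integral_le_lintegral_enorm _).trans ?_
    calc _ ≤ ∫⁻ x, ∑ j, ‖∏ i, F j i x‖ₑ := by
          refine lintegral_mono fun x => ?_
          have h1 := abs_prod_sub_prod_le Finset.univ (fun i => h i (x - v i)) (fun i => h i x)
          simp only [Pi.zero_apply, sub_zero]
          refine le_trans ?_ (enorm_sum_le _ _)
          rw [Real.enorm_eq_ofReal_abs, Real.enorm_eq_ofReal_abs]
          exact ENNReal.ofReal_le_ofReal (h1.trans (le_abs_self _))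
      _ = ∑ j, ∫⁻ x, ‖∏ i, F j i x‖ₑ := by
          refine lintegral_finsetSum' _ fun j _ => ?_
          exact (Finset.aestronglyMeasurable_fun_prod _ fun i _ => hFm j i).enorm
      _ ≤ ∑ _j : Fin (n + 1), ENNReal.ofReal (C * s ^ γ) * P :=
          Finset.sum_le_sum fun j _ => hone j
      _ = _ := by simp
  rw [← Real.norm_eq_abs, ← toReal_enorm]
  refine (ENNReal.toReal_mono ?_ hmain).trans (le_of_eq ?_)
  · exact ENNReal.mul_ne_top (by simp) (ENNReal.mul_ne_top (by simp) hPfin)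
  · rw [ENNReal.toReal_mul, ENNReal.toReal_mul, ENNReal.toReal_ofReal (by positivity)]
    simp only [ENNReal.toReal_natCast]
    push_cast; ring

end Phi

/-- Makes the condition at δ → 0 global: for |t| ≥ δ the bound 2‖f‖_p is absorbed into the constant,
and the sign of the shift is reversed by translation invariance. -/
lemma MemLip.exists_eLpNorm_sub_le {p : ℝ≥0∞} (hp : 1 ≤ p) {γ : ℝ} (hγ : 0 < γ) {f : ℝ → ℝ}
    (hf : MemLip p γ f) : ∃ C : ℝ, 0 ≤ C ∧ ∀ t : ℝ,
      eLpNorm (fun x => f (x - t) - f x) p volume ≤ ENNReal.ofReal (C * |t| ^ γ) := by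
  obtain ⟨hfp, C₀, hC₀⟩ := hf
  obtain ⟨δ, hδ, hb⟩ := mem_nhdsGT_iff_exists_Ioo_subset.1 hC₀
  have hδ : 0 < δ := hδ
  set N : ℝ := (eLpNorm f p volume).toReal with hN
  refine ⟨|C₀| + 2 * N / δ ^ γ, by positivity, fun t => ?_⟩
  have hm := aestronglyMeasurable_comp_sub_right hfp.1 t
  rcases le_or_gt δ |t| with ht | ht
  · have h1 : eLpNorm (fun x => f (x - t) - f x) p volume ≤ ENNReal.ofReal (2 * N) := by
      refine (eLpNorm_sub_le hm hfp.1 hp).trans (le_of_eq ?_)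
      rw [eLpNorm_comp_sub_right hfp.1, ← two_mul, ENNReal.ofReal_mul (by norm_num), hN,
        ENNReal.ofReal_toReal hfp.2.ne]
      simp
    refine h1.trans (ENNReal.ofReal_le_ofReal ?_)
    calc 2 * N = 2 * N / δ ^ γ * δ ^ γ := by field_simp
      _ ≤ (|C₀| + 2 * N / δ ^ γ) * |t| ^ γ := by
        gcongr
        exact le_add_of_nonneg_left (abs_nonneg _)
  · rcases eq_or_ne t 0 with rfl | ht0
    · simp
    have htp : 0 < |t| := abs_pos.2 ht0
    have h2 : eLpNorm (fun x => f (x + |t|) - f x) p volume ≤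
        ENNReal.ofReal ((|C₀| + 2 * N / δ ^ γ) * |t| ^ γ) := by
      have h3 : eLpNorm (fun x => f (x + |t|) - f x) p volume ≤ lpModulus p f |t| :=
        le_iSup₂_of_le (f := fun h _ => eLpNorm (fun x => f (x + h) - f x) p volume) |t|
          (Set.mem_Ioc.2 ⟨htp, le_rfl⟩) le_rfl
      have h4 : lpModulus p f |t| ≤ ENNReal.ofReal (C₀ * |t| ^ γ) := hb ⟨htp, ht⟩
      refine h3.trans (h4.trans (ENNReal.ofReal_le_ofReal ?_))
      gcongr
      exact (le_abs_self C₀).trans (le_add_of_nonneg_right (by positivity))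
    rcases le_total t 0 with hneg | hpos
    · rwa [abs_of_nonpos hneg] at h2 ⊢
    · rw [abs_of_nonneg hpos] at h2 ⊢
      refine le_trans (le_of_eq ?_) h2
      have hm2 : AEStronglyMeasurable (fun x => f (x + t) - f x) volume :=
        (hfp.1.comp_measurePreserving (measurePreserving_add_right volume t)).sub hfp.1
      have h5 := eLpNorm_comp_sub_right (p := p) hm2 t
      simp only [sub_add_cancel] at h5
      rw [← h5]
      exact eLpNorm_sub_comm (fun x => f (x - t)) f p volume

/-- Under the hypotheses of the `L^p` criterion, `φ` is bounded and Hölder continuous at `0`. -/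
lemma phi_regular_of_memLip {n : ℕ} {h : Fin (n + 1) → ℝ → ℝ} (h_int : ∀ i, Integrable (h i))
    {p : Fin (n + 1) → ℝ≥0∞} {γ : ℝ} (hγ : 0 < γ) (hp : ∀ i, 1 ≤ p i) (hsum : ∑ i, (p i)⁻¹ ≤ 1)
    (hL : ∀ i, MemLip (p i) γ (h i)) :
    Integrable (fun l => ∏ i, h i l) ∧ MemLp (phi h) ∞ volume ∧
      ∃ D : ℝ, 0 ≤ D ∧ ∀ u : Fin n → ℝ, |phi h u - phi h 0| ≤ D * (∑ i, |u i|) ^ γ := by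
  set r : ℝ≥0∞ := ∑ i : Fin n, (p i.succ)⁻¹ with hr
  rw [Fin.sum_univ_succ] at hsum
  have hr1 : r ≤ 1 := le_add_self.trans hsum
  -- Lowering only the first exponent makes the reciprocals sum to exactly 1. This is allowed since
  -- h 0 lies in L¹ ∩ L^{p 0}.
  set q : Fin (n + 1) → ℝ≥0∞ := Fin.cons (1 - r)⁻¹ fun i => p i.succ with hq
  have hq1 : ∀ i, 1 ≤ q i := fun i => by
    refine Fin.cases ?_ (fun j => ?_) i
    · simp only [hq, Fin.cons_zero, ENNReal.one_le_inv]
      exact tsub_le_self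
    · simpa only [hq, Fin.cons_succ] using hp j.succ
  have hqs : ∑ i, (q i)⁻¹ = 1 := by
    simp only [Fin.sum_univ_succ, hq, Fin.cons_zero, Fin.cons_succ, inv_inv]
    exact tsub_add_cancel_of_le hr1
  have hqm : ∀ i, MemLp (h i) (q i) volume := fun i => by
    refine Fin.cases ?_ (fun j => ?_) i
    · refine MemLp.of_integrable_of_le (h_int 0) (hL 0).1 (hq1 0) ?_
      simp only [hq, Fin.cons_zero]
      rw [ENNReal.inv_le_iff_inv_le]
      exact ENNReal.le_sub_of_add_le_right (ne_top_of_le_ne_top ENNReal.one_ne_top hr1) hsum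
    · simpa only [hq, Fin.cons_succ] using (hL j.succ).1
  choose C hC hCb using fun i : Fin n => (hL i.succ).exists_eLpNorm_sub_le (hp i.succ) hγ
  obtain ⟨B, hB⟩ := exists_abs_phi_le hqs hqm
  refine ⟨integrable_prod_of_memLp hqs hqm,
    memLp_top_of_bound (aestronglyMeasurable_phi h_int) B (ae_of_all _ hB), ?_⟩
  refine exists_abs_phi_sub_le (C := ∑ i, C i) hq1 hqs hqm (Finset.sum_nonneg fun i _ => hC i) hγ
    fun i t => ?_
  simp only [hq, Fin.cons_succ]
  refine (hCb i t).trans (ENNReal.ofReal_le_ofReal ?_)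
  gcongr
  exact Finset.single_le_sum (fun i _ => hC i) (Finset.mem_univ i)

/-! ### Trace approximation under a Hölder condition on `φ` -/

lemma S_sub_isBigO_of_memLp_top {n : ℕ} {h : Fin (n + 1) → ℝ → ℝ} (hh : ∀ i, Integrable (h i))
    {C γ : ℝ} (hC : 0 ≤ C) (hγ : 0 < γ) (hγ1 : γ ≤ 1) (hb : MemLp (phi h) ∞ volume)
    (hphi : ∀ᵐ u : Fin n → ℝ, |phi h u - phi h 0| ≤ C * (∑ i, |u i|) ^ γ) {ε : ℝ} (hε : 0 < ε) :
    (fun T : ℝ => S h T - (∫ x, fejerKer n x) * (phi h 0 : ℂ)) =O[atTop]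
      fun T : ℝ => T ^ (-γ + ε) := by
  -- An exponent strictly between 0 and γ, hence below 1 as the weighted kernel bound requires. The
  -- Hölder bound persists for it: when |u| ≥ 1, boundedness of φ suffices.
  set γ' : ℝ := max (γ - ε) (γ / 2) with hγ'
  have h0 : 0 < γ' := lt_max_of_lt_right (by linarith)
  have h1 : γ' < γ := max_lt (by linarith) (by linarith)
  obtain ⟨B, hB⟩ : ∃ B : ℝ, ∀ᵐ u, |phi h u| ≤ B :=
    ⟨(eLpNormEssSup (phi h) volume).toReal, by
      have h2 : eLpNormEssSup (phi h) volume ≠ ∞ := by simpa using hb.2.ne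
      filter_upwards [enorm_ae_le_eLpNormEssSup (phi h) volume] with u hu
      rw [← Real.norm_eq_abs, ← toReal_enorm]
      exact ENNReal.toReal_mono h2 hu⟩
  have hphi' : ∀ᵐ u : Fin n → ℝ,
      |phi h u - phi h 0| ≤ (C + |B| + |phi h 0|) * (∑ i, |u i|) ^ γ' := by
    filter_upwards [hphi, hB] with u hu hBu
    have hs : 0 ≤ ∑ i, |u i| := Finset.sum_nonneg fun i _ => abs_nonneg _
    rcases le_total (∑ i, |u i|) 1 with hle | hge
    · refine hu.trans ?_
      have h3 : (∑ i, |u i|) ^ γ ≤ (∑ i, |u i|) ^ γ' :=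
        Real.rpow_le_rpow_of_exponent_ge' hs hle h0.le h1.le
      refine mul_le_mul ?_ h3 (by positivity) (by positivity)
      linarith [abs_nonneg B, abs_nonneg (phi h 0)]
    · refine (abs_sub _ _).trans ?_
      have h3 : 1 ≤ (∑ i, |u i|) ^ γ' := Real.one_le_rpow hge h0.le
      refine le_trans ?_ (le_mul_of_one_le_right (by positivity) h3)
      linarith [le_abs_self B]
  refine (S_sub_isBigO hh h0 (h1.trans_le hγ1) hphi').trans ?_
  refine IsBigO.of_bound 1 ?_
  filter_upwards [eventually_ge_atTop 1] with T hT
  rw [Real.norm_of_nonneg (by positivity), Real.norm_of_nonneg (by positivity), one_mul]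
  refine Real.rpow_le_rpow_of_exponent_le hT ?_
  have : γ - ε ≤ γ' := le_max_left _ _
  linarith

/-! ### The mass of the kernel -/

section Gaussian

/-- The Gaussian `e^{-x²}`. -/
def gauss (x : ℝ) : ℝ := Real.exp (-1 * x ^ 2)

lemma integrable_gauss : Integrable gauss := integrable_exp_neg_mul_sq one_pos

lemma norm_hat_gauss (t : ℝ) :
    ‖hat gauss t‖ = ‖((Real.pi : ℂ) / 1) ^ (1 / 2 : ℂ)‖ * Real.exp (-(1 / 4) * t ^ 2) := by
  have h1 := fourierIntegral_gaussian (b := 1) (by simp) t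
  have h2 : hat gauss t =
      ∫ x : ℝ, Complex.exp (Complex.I * t * x) * Complex.exp (-1 * (x : ℂ) ^ 2) := by
    rw [hat]
    congr 1; funext x
    rw [gauss, mul_right_comm]
    push_cast
    rfl
  have h3 : (-(t : ℂ) ^ 2 / (4 * 1)) = ((-(1 / 4) * t ^ 2 : ℝ) : ℂ) := by push_cast; ring
  rw [h2, h1, norm_mul, h3, Complex.norm_exp_ofReal]

lemma memF1_gauss : MemF1 gauss := by
  refine ⟨integrable_gauss, ?_⟩
  simp only [norm_hat_gauss]
  refine ((integrable_mul_exp_neg_mul_sq (b := 1 / 4) (by norm_num)).norm.const_mul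
    ‖((Real.pi : ℂ) / 1) ^ (1 / 2 : ℂ)‖).congr (ae_of_all _ fun t => ?_)
  simp only [norm_mul, Real.norm_eq_abs, Real.abs_exp]
  ring

lemma hasDerivAt_gauss (x : ℝ) : HasDerivAt gauss (Real.exp (-1 * x ^ 2) * (-1 * (2 * x))) x := by
  have h : HasDerivAt gauss (Real.exp (-1 * x ^ 2) * (-1 * ((2 : ℕ) * x ^ (2 - 1)))) x :=
    ((hasDerivAt_pow 2 x).const_mul (-1 : ℝ)).exp
  simpa only [Nat.cast_ofNat, Nat.add_one_sub_one, pow_one] using h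

lemma abs_gauss_sub_le (x y : ℝ) : |gauss y - gauss x| ≤ |y - x| := by
  have h := convex_univ.norm_image_sub_le_of_norm_hasDerivWithin_le (C := 1) (f := gauss)
    (fun z _ => (hasDerivAt_gauss z).hasDerivWithinAt) (fun z _ => ?_) (Set.mem_univ x)
    (Set.mem_univ y)
  · simpa using h
  · rw [norm_mul, Real.norm_eq_abs, Real.norm_eq_abs, Real.abs_exp, neg_one_mul, Real.exp_neg,
      inv_mul_le_iff₀ (Real.exp_pos _), mul_one]
    -- The derivative is bounded by 1 because |2z| ≤ z² + 1 ≤ e^{z²}.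
    refine le_trans ?_ (Real.add_one_le_exp _)
    rw [neg_one_mul, abs_neg, abs_mul, abs_two]
    nlinarith [sq_nonneg (|z| - 1), sq_abs z]

lemma memLip_gauss : MemLip ∞ 1 gauss := by
  refine ⟨memLp_top_of_bound integrable_gauss.1 1 (ae_of_all _ fun x => ?_), 1, ?_⟩
  · rw [gauss, Real.norm_eq_abs, Real.abs_exp, Real.exp_le_one_iff]
    nlinarith [sq_nonneg x]
  · filter_upwards with δ
    refine iSup₂_le fun t ht => ?_
    refine (eLpNorm_le_of_ae_bound (C := 1 * δ ^ (1 : ℝ)) (ae_of_all _ fun x => ?_)).trans ?_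
    · refine (abs_gauss_sub_le x (x + t)).trans ?_
      rw [add_sub_cancel_left, abs_of_pos ht.1, Real.rpow_one, one_mul]
      exact ht.2
    · simp

/-- For Gaussian symbols S(T) tends to φ(0)∫K by the kernel expansion and to (2π)^n φ(0) by the F₁
case; positivity gives φ(0) ≠ 0, which can be cancelled. -/
lemma integral_fejerKer (n : ℕ) : ∫ x, fejerKer n x = (2 * Real.pi : ℂ) ^ n := by
  set h : Fin (n + 1) → ℝ → ℝ := fun _ => gauss with hdef
  have hh : ∀ i, Integrable (h i) := fun _ => integrable_gauss
  obtain ⟨-, hb, D, hD, hphi⟩ := phi_regular_of_memLip (h := h) hh (p := fun _ => ∞) one_pos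
    (fun _ => le_top) (by simp) fun _ => memLip_gauss
  have h1 := S_sub_isBigO_of_memLp_top hh hD one_pos le_rfl hb (ae_of_all _ hphi) one_half_pos
  have h2 := (trace_approximation_of_memF1 h fun _ => memF1_gauss).2
  have t1 : Tendsto (fun T => S h T - (∫ x, fejerKer n x) * (phi h 0 : ℂ)) atTop (𝓝 0) := by
    refine h1.trans_tendsto ?_
    have : (-1 + 1 / 2 : ℝ) = -(1 / 2) := by norm_num
    rw [this]
    exact tendsto_rpow_neg_atTop one_half_pos
  have t2 : Tendsto (fun T => S h T - (M h : ℂ)) atTop (𝓝 0) :=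
    tendsto_zero_iff_norm_tendsto_zero.2
      (h2.trans_tendsto (tendsto_rpow_neg_atTop one_pos))
  have t3 := t1.sub t2
  simp only [sub_sub_sub_cancel_left, sub_zero] at t3
  have h3 := tendsto_nhds_unique tendsto_const_nhds t3
  rw [M_eq] at h3
  have h4 : phi h 0 ≠ 0 := by
    have hi : Integrable (fun l => ∏ i, h i l) :=
      (trace_approximation_of_memF1 h fun _ => memF1_gauss).1
    have e : phi h 0 = ∫ l, ∏ i, h i l := by
      simp only [phi, Pi.zero_apply, sub_zero, Fin.prod_univ_succ]
    have hpos : ∀ l, 0 < ∏ i, h i l := fun l => Finset.prod_pos fun i _ => Real.exp_pos _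
    rw [e]
    refine ((integral_pos_iff_support_of_nonneg (fun l => (hpos l).le) hi).2 ?_).ne'
    have : Function.support (fun l => ∏ i, h i l) = Set.univ :=
      Set.eq_univ_of_forall fun l => (hpos l).ne'
    rw [this]; simp
  have h5 : (phi h 0 : ℂ) ≠ 0 := by exact_mod_cast h4
  push_cast at h3
  rw [← sub_mul] at h3
  have h6 := (mul_eq_zero.1 h3).resolve_right h5 |> sub_eq_zero.1
  exact h6.symm

end Gaussian

/-- The trace approximation under a Hölder condition on `φ` at the origin. -/
theorem trace_approximation_of_phi {n : ℕ} {h : Fin (n + 1) → ℝ → ℝ}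
    (hh : ∀ i, Integrable (h i)) {C γ : ℝ} (hC : 0 ≤ C) (hγ : 0 < γ) (hγ1 : γ ≤ 1)
    (hb : MemLp (phi h) ∞ volume)
    (hphi : ∀ᵐ u : Fin n → ℝ, |phi h u - phi h 0| ≤ C * (∑ i, |u i|) ^ γ) {ε : ℝ} (hε : 0 < ε) :
    (fun T : ℝ => Delta h T) =O[atTop] fun T : ℝ => T ^ (-γ + ε) := by
  have h1 := S_sub_isBigO_of_memLp_top hh hC hγ hγ1 hb hphi hε
  refine h1.norm_left.congr_left fun T => ?_
  rw [Delta, M_eq, integral_fejerKer]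
  push_cast
  rfl

/-- The trace approximation for symbols in `L^p`-Lipschitz classes. -/
theorem trace_approximation_of_memLip {n : ℕ} {h : Fin (n + 1) → ℝ → ℝ}
    (hh : ∀ i, Integrable (h i)) {p : Fin (n + 1) → ℝ≥0∞} {γ : ℝ} (hγ : 0 < γ) (hγ1 : γ ≤ 1)
    (hp : ∀ i, 1 ≤ p i) (hsum : ∑ i, (p i)⁻¹ ≤ 1) (hL : ∀ i, MemLip (p i) γ (h i)) :
    Integrable (fun l => ∏ i, h i l) ∧ ∀ ε : ℝ, 0 < ε →
      (fun T : ℝ => Delta h T) =O[atTop] fun T : ℝ => T ^ (-γ + ε) := by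
  obtain ⟨hi, hb, D, hD, hphi⟩ := phi_regular_of_memLip hh hγ hp hsum hL
  exact ⟨hi, fun ε hε => trace_approximation_of_phi hh hD hγ hγ1 hb (ae_of_all _ hphi) hε⟩

/-! ### Symbols with a power singularity at the origin -/

lemma integrableOn_abs_rpow {s : ℝ} (hs : -1 < s) (R : ℝ) :
    IntegrableOn (fun x : ℝ => |x| ^ s) (Set.Icc (-R) R) := by
  rcases lt_or_ge R 0 with hR | hR
  · rw [Set.Icc_eq_empty (by linarith)]; exact integrableOn_empty
  have h1 : IntervalIntegrable (fun x : ℝ => |x| ^ s) volume 0 R := by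
    refine (intervalIntegral.intervalIntegrable_rpow' hs).congr ?_
    intro x hx
    rw [Set.uIoc_of_le hR] at hx
    simp only [abs_of_pos hx.1]
  have h2 : IntervalIntegrable (fun x : ℝ => |x| ^ s) volume (-R) 0 := by
    have := ((IntervalIntegrable.iff_comp_neg (by simp)).1 h1).symm
    simpa only [abs_neg, neg_zero] using! this
  have h3 := h2.trans h1
  rwa [intervalIntegrable_iff_integrableOn_Icc_of_le (by linarith)] at h3

lemma memLp_of_norm_rpow_le {f g : ℝ → ℝ} {p : ℝ≥0∞} (hp : 1 ≤ p) (hpt : p ≠ ∞)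
    (hf : AEStronglyMeasurable f volume) (hg : Integrable g)
    (hfg : ∀ᵐ x, |f x| ^ p.toReal ≤ g x) : MemLp f p volume := by
  rw [← integrable_norm_rpow_iff hf (zero_lt_one.trans_le hp).ne' hpt]
  refine hg.mono' (hf.norm.aemeasurable.pow_const _).aestronglyMeasurable ?_
  filter_upwards [hfg] with x hx
  rwa [Real.norm_of_nonneg (by positivity)]

lemma memLp_indicator_abs_rpow {p : ℝ≥0∞} (hp : 1 ≤ p) (hpt : p ≠ ∞) {σ : ℝ}
    (hσp : σ * p.toReal < 1) (R : ℝ) :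
    MemLp ((Set.Icc (-R) R).indicator fun x : ℝ => |x| ^ (-σ)) p volume := by
  have hm : Measurable fun x : ℝ => |x| ^ (-σ) := measurable_id.abs.pow_const _
  refine memLp_of_norm_rpow_le hp hpt (hm.indicator measurableSet_Icc).aestronglyMeasurable
    ((integrable_indicator_iff measurableSet_Icc).2
      (integrableOn_abs_rpow (s := -(σ * p.toReal)) (by linarith) R)) (ae_of_all _ fun x => ?_)
  by_cases hx : x ∈ Set.Icc (-R) R
  · rw [Set.indicator_of_mem hx, Set.indicator_of_mem hx, abs_of_nonneg (by positivity),
      ← Real.rpow_mul (abs_nonneg x), neg_mul]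
  · rw [Set.indicator_of_notMem hx, Set.indicator_of_notMem hx, abs_zero, Real.zero_rpow]
    exact (ENNReal.toReal_pos (zero_lt_one.trans_le hp).ne' hpt).ne'

lemma memLp_one_add_abs_rpow {p : ℝ≥0∞} (hp : 1 ≤ p) (hpt : p ≠ ∞) {s : ℝ}
    (hs : 1 < s * p.toReal) : MemLp (fun x : ℝ => (1 + |x|) ^ (-s)) p volume := by
  have hi : Integrable fun x : ℝ => (1 + |x|) ^ (-(s * p.toReal)) :=
    integrable_one_add_norm (E := ℝ) (by simpa using hs)
  refine memLp_of_norm_rpow_le hp hpt ?_ hi (ae_of_all _ fun x => le_of_eq ?_)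
  · exact (Measurable.pow_const (by fun_prop) _).aestronglyMeasurable
  · rw [abs_of_nonneg (by positivity), ← Real.rpow_mul (by positivity), neg_mul]

lemma eLpNorm_comp_div {p : ℝ≥0∞} (hpt : p ≠ ∞) {f : ℝ → ℝ} (hf : AEStronglyMeasurable f volume)
    {u : ℝ} (hu : 0 < u) : eLpNorm (fun x => f (u⁻¹ * x)) p volume =
      ENNReal.ofReal (u ^ (1 / p.toReal)) * eLpNorm f p volume := by
  have hmap : Measure.map (fun x : ℝ => u⁻¹ * x) volume = ENNReal.ofReal u • volume := by
    have := Real.map_volume_mul_left (inv_ne_zero hu.ne')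
    rwa [inv_inv, abs_of_pos hu] at this
  have h1 := eLpNorm_map_measure (μ := volume) (f := fun x : ℝ => u⁻¹ * x) (g := f) (p := p)
    (by rw [hmap]; exact hf.smul_measure _) (by fun_prop)
  rw [hmap, eLpNorm_smul_measure_of_ne_top hpt] at h1
  have h2 : eLpNorm (fun x => f (u⁻¹ * x)) p volume = eLpNorm (f ∘ fun x => u⁻¹ * x) p volume := rfl
  rw [h2, ← h1, smul_eq_mul, ENNReal.ofReal_rpow_of_pos hu]
  simp

/-- Measuring position in units of the shift u brings out the factor u^{-σ}. For |x| ≤ 2 the two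
values are bounded separately, with singularities at 0 and -1; for |x| > 2 the mean value inequality
applies. -/
lemma abs_sub_le_of_power_bounds {f : ℝ → ℝ} {C σ : ℝ} (hC : 0 < C) (hσ : 0 < σ)
    (hd : ∀ l : ℝ, l ≠ 0 → DifferentiableAt ℝ f l)
    (hf : ∀ l : ℝ, l ≠ 0 → |f l| ≤ C * |l| ^ (-σ))
    (hf' : ∀ l : ℝ, l ≠ 0 → |deriv f l| ≤ C * |l| ^ (-σ - 1)) {u x : ℝ} (hu : 0 < u) (hx : x ≠ 0)
    (hxu : u * x + u ≠ 0) :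
    |f (u * x + u) - f (u * x)| ≤ C * 4 ^ (σ + 1) * u ^ (-σ) *
      ((Set.Icc (-2) 2).indicator (fun x : ℝ => |x| ^ (-σ)) x +
        (Set.Icc (-3) 3).indicator (fun x : ℝ => |x| ^ (-σ)) (x + 1) +
        (1 + |x|) ^ (-(σ + 1))) := by
  have hax : 0 < |x| := abs_pos.2 hx
  have h4 : (1 : ℝ) ≤ 4 ^ (σ + 1) := Real.one_le_rpow (by norm_num) (by linarith)
  have hind : ∀ (R y : ℝ), 0 ≤ (Set.Icc (-R) R).indicator (fun x : ℝ => |x| ^ (-σ)) y :=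
    fun R y => Set.indicator_nonneg (fun z _ => by positivity) y
  rcases le_or_gt |x| 2 with h2 | h2
  · rw [Set.indicator_of_mem (show x ∈ Set.Icc (-2 : ℝ) 2 from abs_le.1 h2),
      Set.indicator_of_mem (show x + 1 ∈ Set.Icc (-3 : ℝ) 3 from
        ⟨by linarith [(abs_le.1 h2).1], by linarith [(abs_le.1 h2).2]⟩)]
    have e1 : |u * x| ^ (-σ) = u ^ (-σ) * |x| ^ (-σ) := by
      rw [abs_mul, abs_of_pos hu, Real.mul_rpow hu.le (abs_nonneg _)]
    have e2 : |u * x + u| ^ (-σ) = u ^ (-σ) * |x + 1| ^ (-σ) := by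
      rw [show u * x + u = u * (x + 1) by ring, abs_mul, abs_of_pos hu,
        Real.mul_rpow hu.le (abs_nonneg _)]
    calc |f (u * x + u) - f (u * x)| ≤ |f (u * x + u)| + |f (u * x)| := abs_sub _ _
      _ ≤ C * |u * x + u| ^ (-σ) + C * |u * x| ^ (-σ) :=
        add_le_add (hf _ hxu) (hf _ (mul_ne_zero hu.ne' hx))
      _ = C * 1 * u ^ (-σ) * (|x| ^ (-σ) + |x + 1| ^ (-σ) + 0) := by rw [e1, e2]; ring
      _ ≤ _ := by gcongr; positivity
  -- Here |z| ≥ u|x| - u, and |x| > 2, so the segment avoids the singularity.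
  · have hseg : ∀ z ∈ Set.Icc (u * x) (u * x + u), u * (|x| / 2) ≤ |z| := by
      intro z hz
      have h5 : |u * x - z| ≤ u := abs_le.2 ⟨by linarith [hz.2], by linarith [hz.1]⟩
      have h6 := abs_sub_abs_le_abs_sub (u * x) z
      rw [abs_mul, abs_of_pos hu] at h6
      nlinarith
    have hz0 : ∀ z ∈ Set.Icc (u * x) (u * x + u), z ≠ 0 := fun z hz =>
      abs_pos.1 ((by positivity : 0 < u * (|x| / 2)).trans_le (hseg z hz))
    have hmv := (convex_Icc (u * x) (u * x + u)).norm_image_sub_le_of_norm_deriv_le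
      (C := C * (u * (|x| / 2)) ^ (-σ - 1)) (f := f) (fun z hz => hd z (hz0 z hz))
      (fun z hz => ?_) (Set.left_mem_Icc.2 (by linarith)) (Set.right_mem_Icc.2 (by linarith))
    · rw [Real.norm_eq_abs, add_sub_cancel_left, Real.norm_of_nonneg hu.le] at hmv
      refine hmv.trans ?_
      -- The 4 comes from |x|/2 ≥ (1 + |x|)/4.
      have h7 : (|x| / 2) ^ (-σ - 1) ≤ 4 ^ (σ + 1) * (1 + |x|) ^ (-(σ + 1)) := by
        have e : (4 : ℝ) ^ (σ + 1) = (4⁻¹ : ℝ) ^ (-(σ + 1)) := by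
          rw [Real.inv_rpow (by norm_num), Real.rpow_neg (by norm_num), inv_inv]
        rw [e, ← Real.mul_rpow (by norm_num) (by positivity), show -σ - 1 = -(σ + 1) by ring]
        refine Real.rpow_le_rpow_of_nonpos (by positivity) (by linarith) (by linarith)
      have e3 : (u * (|x| / 2)) ^ (-σ - 1) * u = u ^ (-σ) * (|x| / 2) ^ (-σ - 1) := by
        rw [Real.mul_rpow hu.le (by positivity), Real.rpow_sub_one hu.ne']
        field_simp
      calc C * (u * (|x| / 2)) ^ (-σ - 1) * u = C * u ^ (-σ) * (|x| / 2) ^ (-σ - 1) := by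
            rw [mul_assoc, e3]; ring
        _ ≤ C * u ^ (-σ) * (4 ^ (σ + 1) * (1 + |x|) ^ (-(σ + 1))) := by gcongr
        _ = C * 4 ^ (σ + 1) * u ^ (-σ) * (1 + |x|) ^ (-(σ + 1)) := by ring
        _ ≤ _ := by
          gcongr
          exact le_add_of_nonneg_left (add_nonneg (hind 2 x) (hind 3 (x + 1)))
    · rw [Real.norm_eq_abs]
      refine (hf' z (hz0 z hz)).trans ?_
      refine mul_le_mul_of_nonneg_left ?_ hC.le
      exact Real.rpow_le_rpow_of_nonpos (by positivity) (hseg z hz) (by linarith)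

/-- The increment is bounded by u^{-σ} G(x/u), whose L^p norm scales like u^{1/p - σ} = u^γ. G lies
in L^p because σp < 1 < (σ+1)p. -/
lemma memLip_of_power_bounds {f : ℝ → ℝ} (hfi : Integrable f) {C σ γ : ℝ} {p : ℝ≥0∞} (hC : 0 < C)
    (hσ : 0 < σ) (hγ : 0 < γ) (hp : 1 ≤ p) (hpt : p ≠ ∞) (hpσ : 1 / p.toReal = σ + γ)
    (hd : ∀ l : ℝ, l ≠ 0 → DifferentiableAt ℝ f l)
    (hf : ∀ l : ℝ, l ≠ 0 → |f l| ≤ C * |l| ^ (-σ))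
    (hf' : ∀ l : ℝ, l ≠ 0 → |deriv f l| ≤ C * |l| ^ (-σ - 1)) : MemLip p γ f := by
  have hp0 : 0 < p.toReal := ENNReal.toReal_pos (zero_lt_one.trans_le hp).ne' hpt
  have hp1 : 1 ≤ p.toReal := by
    rw [← ENNReal.toReal_one]; exact ENNReal.toReal_mono hpt hp
  have hσp : σ * p.toReal < 1 := by
    have : (σ + γ) * p.toReal = 1 := by rw [← hpσ]; field_simp
    nlinarith
  have hne : ∀ a : ℝ, ∀ᵐ x : ℝ, x ≠ a := fun a => by simp [ae_iff]
  have hfp : MemLp f p volume := by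
    rw [← Set.indicator_self_add_compl (Set.Icc (-1 : ℝ) 1) f]
    refine MemLp.add ?_ ?_
    · refine ((memLp_indicator_abs_rpow hp hpt hσp 1).const_mul C).mono
        (hfi.1.indicator measurableSet_Icc) ?_
      filter_upwards [hne 0] with x hx
      by_cases hx1 : x ∈ Set.Icc (-1 : ℝ) 1
      · rw [Set.indicator_of_mem hx1, Set.indicator_of_mem hx1]
        exact (hf x hx).trans (le_abs_self _)
      · rw [Set.indicator_of_notMem hx1, norm_zero]
        exact norm_nonneg _
    · refine MemLp.of_integrable_of_le (p := ∞) (hfi.indicator measurableSet_Icc.compl)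
        (memLp_top_of_bound (hfi.1.indicator measurableSet_Icc.compl) C (ae_of_all _ fun x => ?_))
        hp le_top
      by_cases hx1 : x ∈ Set.Icc (-1 : ℝ) 1
      · rw [Set.indicator_of_notMem (by simpa using! hx1), norm_zero]
        exact hC.le
      · rw [Set.indicator_of_mem (by simpa using! hx1)]
        have h1 : 1 < |x| := by
          by_contra! hc
          exact hx1 (abs_le.1 hc)
        have hx0 : x ≠ 0 := abs_pos.1 (by linarith)
        refine (hf x hx0).trans (mul_le_of_le_one_right hC.le ?_)
        exact Real.rpow_le_one_of_one_le_of_nonpos h1.le (by linarith)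
  set G : ℝ → ℝ := fun x => (Set.Icc (-2) 2).indicator (fun x : ℝ => |x| ^ (-σ)) x +
        (Set.Icc (-3) 3).indicator (fun x : ℝ => |x| ^ (-σ)) (x + 1) +
        (1 + |x|) ^ (-(σ + 1)) with hG
  have hGp : MemLp G p volume := by
    refine ((memLp_indicator_abs_rpow hp hpt hσp 2).add ?_).add
      (memLp_one_add_abs_rpow hp hpt (by nlinarith))
    exact (memLp_indicator_abs_rpow hp hpt hσp 3).comp_measurePreserving
      (measurePreserving_add_right volume 1)
  refine ⟨hfp, C * 4 ^ (σ + 1) * (eLpNorm G p volume).toReal, ?_⟩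
  filter_upwards [self_mem_nhdsWithin] with δ hδ
  refine iSup₂_le fun u hu => ?_
  have hu0 : 0 < u := hu.1
  have hb : ∀ᵐ x : ℝ, ‖f (x + u) - f x‖ ≤ C * 4 ^ (σ + 1) * u ^ (-σ) * ‖G (u⁻¹ * x)‖ := by
    filter_upwards [hne 0, hne (-u)] with x hx hxu
    have e : u * (u⁻¹ * x) = x := by field_simp
    have h1 := abs_sub_le_of_power_bounds hC hσ hd hf hf' hu0 (x := u⁻¹ * x)
      (mul_ne_zero (inv_ne_zero hu0.ne') hx)
      (by rw [e]; exact fun hc => hxu (by linarith))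
    rw [e] at h1
    refine h1.trans ?_
    gcongr
    exact le_abs_self _
  refine (eLpNorm_le_mul_eLpNorm_of_ae_le_mul hb p).trans ?_
  rw [eLpNorm_comp_div hpt hGp.1 hu0, hpσ, ← ENNReal.ofReal_toReal hGp.2.ne,
    ← ENNReal.ofReal_mul (by positivity), ← ENNReal.ofReal_mul (by positivity)]
  refine ENNReal.ofReal_le_ofReal ?_
  have e2 : u ^ (-σ) * u ^ (σ + γ) = u ^ γ := by
    rw [← Real.rpow_add hu0]; congr 1; ring
  rw [ENNReal.toReal_ofReal ENNReal.toReal_nonneg]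
  calc _ = C * 4 ^ (σ + 1) * (eLpNorm G p volume).toReal * u ^ γ := by
        rw [← e2]; ring
    _ ≤ _ := by
        gcongr
        exact hu.2

/-- The trace approximation for symbols with power singularities at the origin. -/
theorem trace_approximation_of_power_bounds {n : ℕ} {h : Fin (n + 1) → ℝ → ℝ}
    (hh : ∀ i, Integrable (h i)) {C σ δ : Fin (n + 1) → ℝ} (hC : ∀ i, 0 < C i)
    (hσ : ∀ i, 0 < σ i) (hδ : ∀ i, 1 < δ i) (hs : ∑ i, σ i < 1)
    (hd : ∀ i, ∀ l : ℝ, l ≠ 0 → DifferentiableAt ℝ (h i) l)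
    (hnear : ∀ i, ∀ l : ℝ, l ≠ 0 → |l| ≤ 1 →
      |h i l| ≤ C i * |l| ^ (-σ i) ∧ |deriv (h i) l| ≤ C i * |l| ^ (-σ i - 1))
    (hfar : ∀ i, ∀ l : ℝ, 1 < |l| →
      |h i l| ≤ C i * |l| ^ (-δ i) ∧ |deriv (h i) l| ≤ C i * |l| ^ (-δ i - 1)) :
    Integrable (fun l => ∏ i, h i l) ∧ ∀ ε : ℝ, 0 < ε →
      (fun T : ℝ => Delta h T) =O[atTop]
        fun T : ℝ => T ^ (-((1 / ((n : ℝ) + 1)) * (1 - ∑ i, σ i)) + ε) := by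
  have hn : (0 : ℝ) < (n : ℝ) + 1 := by positivity
  set γ : ℝ := (1 / ((n : ℝ) + 1)) * (1 - ∑ i, σ i) with hγdef
  have hγ : 0 < γ := mul_pos (by positivity) (by linarith)
  have hσle : ∀ i, σ i ≤ ∑ i, σ i := fun i =>
    Finset.single_le_sum (fun j _ => (hσ j).le) (Finset.mem_univ i)
  have hγle : γ ≤ 1 - ∑ i, σ i := by
    refine mul_le_of_le_one_left (by linarith) ?_
    rw [div_le_one hn]
    have : (0 : ℝ) ≤ n := Nat.cast_nonneg n
    linarith
  -- The exponents are 1/p_i = σ_i + γ, and γ is the value for which they exactly exhaust Hölder's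
  -- budget.
  have hsum : ∑ i, (σ i + γ) = 1 := by
    rw [Finset.sum_add_distrib, Finset.sum_const, Finset.card_univ, Fintype.card_fin, nsmul_eq_mul,
      hγdef]
    push_cast
    field_simp
    ring
  have hpos : ∀ i, 0 < σ i + γ := fun i => add_pos (hσ i) hγ
  have hbd : ∀ i, ∀ l : ℝ, l ≠ 0 →
      |h i l| ≤ C i * |l| ^ (-σ i) ∧ |deriv (h i) l| ≤ C i * |l| ^ (-σ i - 1) := by
    intro i l hl
    rcases le_or_gt |l| 1 with h1 | h1
    · exact hnear i l hl h1
    -- Since σ_i < 1 < δ_i, the decay at infinity is stronger than |l|^{-σ_i}, so one power bound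
    -- serves on all of ℝ∖{0}.
    · have hσδ : σ i ≤ δ i := by linarith [hσle i, hδ i]
      have hCi := (hC i).le
      refine ⟨(hfar i l h1).1.trans ?_, (hfar i l h1).2.trans ?_⟩
      · refine mul_le_mul_of_nonneg_left ?_ hCi
        exact Real.rpow_le_rpow_of_exponent_le h1.le (by linarith)
      · refine mul_le_mul_of_nonneg_left ?_ hCi
        exact Real.rpow_le_rpow_of_exponent_le h1.le (by linarith)
  have hinv : ∀ i, (ENNReal.ofReal (1 / (σ i + γ)))⁻¹ = ENNReal.ofReal (σ i + γ) := fun i => by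
    rw [one_div, ENNReal.ofReal_inv_of_pos (hpos i), inv_inv]
  refine trace_approximation_of_memLip hh (p := fun i => ENNReal.ofReal (1 / (σ i + γ))) hγ
    (by linarith [hσle 0, hσ 0]) (fun i => ?_) ?_ fun i => ?_
  · rw [ENNReal.one_le_ofReal, le_div_iff₀ (hpos i)]
    linarith [hσle i]
  · simp only [hinv]
    rw [← ENNReal.ofReal_sum_of_nonneg fun i _ => (hpos i).le, hsum, ENNReal.ofReal_one]
  · refine memLip_of_power_bounds (hh i) (hC i) (hσ i) hγ ?_ ENNReal.ofReal_ne_top ?_ (hd i)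
      (fun l hl => (hbd i l hl).1) fun l hl => (hbd i l hl).2
    · rw [ENNReal.one_le_ofReal, le_div_iff₀ (hpos i)]
      linarith [hσle i]
    · rw [ENNReal.toReal_ofReal (one_div_pos.2 (hpos i)).le, one_div_one_div]

end ToeplitzTrace

end

theorem theorem3p2 (n : ℕ) (h : Fin (n + 1) → ℝ → ℝ)
    (h_int : ∀ i, Integrable (h i)) (h_even : ∀ i, Function.Even (h i)) :
    -- the trace is well defined
    (∀ T : ℝ, 0 < T → ToeplitzTrace.IsTraceClass (ToeplitzTrace.toeplitzProd h T)) ∧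
    -- assertion (1)
    ((∀ i, ToeplitzTrace.MemF1 (h i)) →
      Integrable (fun l => ∏ i, h i l) ∧
      (fun T : ℝ => ToeplitzTrace.Delta h T) =O[atTop] fun T : ℝ => T ^ (-1 : ℝ)) ∧
    -- assertion (2)
    (∀ C γ : ℝ, 0 < C → 0 < γ → γ ≤ 1 →
      Integrable (fun l => ∏ i, h i l) →
      MemLp (ToeplitzTrace.phi h) ∞ volume →
      (∀ᵐ u : Fin n → ℝ,
        |ToeplitzTrace.phi h u - ToeplitzTrace.phi h 0| ≤ C * (∑ i, |u i|) ^ γ) →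
      ∀ ε : ℝ, 0 < ε →
        (fun T : ℝ => ToeplitzTrace.Delta h T) =O[atTop] fun T : ℝ => T ^ (-γ + ε)) ∧
    -- assertion (3)
    (∀ (p : Fin (n + 1) → ℝ≥0∞) (γ : ℝ), 0 < γ → γ ≤ 1 → (∀ i, 1 ≤ p i) →
      ∑ i, (p i)⁻¹ ≤ 1 →
      (∀ i, ToeplitzTrace.MemLip (p i) γ (h i)) →
      Integrable (fun l => ∏ i, h i l) ∧
      ∀ ε : ℝ, 0 < ε →
        (fun T : ℝ => ToeplitzTrace.Delta h T) =O[atTop] fun T : ℝ => T ^ (-γ + ε)) ∧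
    -- assertion (4)
    (∀ C σ δ : Fin (n + 1) → ℝ,
      (∀ i, 0 < C i) → (∀ i, 0 < σ i) → (∀ i, 1 < δ i) → ∑ i, σ i < 1 →
      (∀ i, ∀ l : ℝ, l ≠ 0 → DifferentiableAt ℝ (h i) l) →
      (∀ i, ∀ l : ℝ, l ≠ 0 → |l| ≤ 1 →
        |h i l| ≤ C i * |l| ^ (-σ i) ∧ |deriv (h i) l| ≤ C i * |l| ^ (-σ i - 1)) →
      (∀ i, ∀ l : ℝ, 1 < |l| →
        |h i l| ≤ C i * |l| ^ (-δ i) ∧ |deriv (h i) l| ≤ C i * |l| ^ (-δ i - 1)) →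
      Integrable (fun l => ∏ i, h i l) ∧
      ∀ ε : ℝ, 0 < ε →
        (fun T : ℝ => ToeplitzTrace.Delta h T) =O[atTop]
          fun T : ℝ => T ^ (-((1 / ((n : ℝ) + 1)) * (1 - ∑ i, σ i)) + ε)) := by
  refine ⟨fun T _ => ?_, fun hF => ToeplitzTrace.trace_approximation_of_memF1 h hF,
    fun C γ hC hγ hγ1 _ hb hphi ε hε =>
      ToeplitzTrace.trace_approximation_of_phi h_int hC.le hγ hγ1 hb hphi hε,
    fun p γ hγ hγ1 hp hsum hL => ToeplitzTrace.trace_approximation_of_memLip h_int hγ hγ1 hp hsum hL,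
    fun C σ δ hC hσ hδ hs hd hnear hfar =>
      ToeplitzTrace.trace_approximation_of_power_bounds h_int hC hσ hδ hs hd hnear hfar⟩
  rw [ToeplitzTrace.toeplitzProd_eq]
  exact ToeplitzTrace.isTraceClass_toeplitz_mul (h_int 0) _
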